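/- **Asymmetric hub model.** Let $1\le n_L\le n$. Nodes are $1,\dots,n$; nodes $1,\dots,n_L$ are the potential hubs. The parameters are $\rho=(\rho_1,\dots,\rho_{n_L})$ with $\rho_i\ge 0$, $\sum_i\rho_i=1$, and $A\in[0,1]^{n_L\times n}$ with $A_{ii}=1$ for $i\le n_L$. One observes the groups $G^{(1)},\dots,G^{(T)}\in\{0,1\}^n$, where the pairs $(z_*^{(t)},G^{(t)})$, $t=1,\dots,T$, are independent, the latent hub satisfies $\mathbb P(z_*^{(t)}=i)=\rho_i$, and, given $z_*^{(t)}=i$, the coordinates $G^{(t)}_j$ are independent with $\mathbb P(G^{(t)}_j=1\mid z_*^{(t)}=i)=A_{ij}$. For a label assignment $z\in\{1,\dots,n_L\}^T$ put $t_i=\sum_t 1(z^{(t)}=i)$, $$\hat A^z_{ij}=\frac{\sum_t G^{(t)}_j\,1(z^{(t)}=i)}{t_i},\qquad L_G(z)=\sum_{t=1}^T\sum_{j=1}^n \Big(G_j^{(t)}\log \hat A^z_{z^{(t)},j}+(1-G_j^{(t)})\log\big(1-\hat A^z_{z^{(t)},j}\big)\Big)$$ (with $0\log 0=0$). Call $z$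 feasible if $G^{(t)}_{z^{(t)}}=1$ for all $t$, i.e. the assigned hub belongs to the group; since $A_{ii}=1$, all other assignments have likelihood zero. Let $\hat z$ be any maximizer of $L_G$ over the feasible assignments (one exists almost surely). **Theorem.** Consider a sequence of such models in which $n$, $T$, $n_L$, $\rho$, $A$ and $d,v>0$ may vary along the sequence, with $n\to\infty$ and $T\to\infty$. Assume that * there are constants $0<c_{\min *}\le c_{\max *}$ with $c_{\min *}/n_L\le\rho_i\le c_{\max *}/n_L$ for all $i\le n_L$; * for each $i\le n_L$ there is a set $V_i\subset\{1,\dots,n\}$ with $|V_i|\ge vn/n_L$ and $A_{ij}-A_{i'j}\ge d$ for all $j\in V_i$ and all $i'\neq i$, $i'\le n_L$. (a) (Growing number of hubs.) If $n_L\to\infty$, there is a constant $c_0>0$ with $A_{ii'}\le c_0/n_L$ for all $i\ne i'$, $i,i'\le n_L$, and $$\frac{n_L^2\log n_L}{T}\to0,\qquad \frac{n_L^3\log T}{d^2vT}\to0,\qquad \frac{n_L^4\log n_L}{d^4v^2n}\to0,\qquad \frac{n_L\log n}{T}\to0,$$ then $$\max_{1\le i\le n_L,\,1\le j\le n}\big|\hat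 A^{\hat z}_{ij}-A_{ij}\big|=o_p(1).$$ (b) (Fixed number of hubs.) If $n_L$ is fixed, there is a constant $c<1$ with $A_{ii'}\le c$ for all $i\neq i'$, $i,i'\le n_L$, and $$\frac{\log T}{d^2vT}\to0,\qquad d^4v^2n\to\infty,\qquad \frac{\log n}{T}\to0,$$ then likewise $$\max_{1\le i\le n_L,\,1\le j\le n}\big|\hat A^{\hat z}_{ij}-A_{ij}\big|=o_p(1).$$ -/

import Mathlib

open MeasureTheory ProbabilityTheory Filter Topology

/-- Parameters of the asymmetric hub model with `n` nodes of which the first `nL` are the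
potential hubs: `ρ i` is the probability that a group is formed by hub `i`, and `A i j` is the
probability that node `j` appears in a group formed by hub `i`. A hub always appears in its own
groups, so `A i i = 1`; hub `i` is node `Fin.castLE le i`. -/
structure HubParams (nL n : ℕ) where
  le : nL ≤ n
  ρ : Fin nL → ℝ
  A : Fin nL → Fin n → ℝ
  ρ_nonneg : ∀ i, 0 ≤ ρ i
  ρ_sum : ∑ i, ρ i = 1
  A_nonneg : ∀ i j, 0 ≤ A i j
  A_le_one : ∀ i j, A i j ≤ 1
  A_self : ∀ i, A i (Fin.castLE le i) = 1

/-- `z t` (hub labels) and `G t` (membership vectors), `t = 1, …, T`, are a sample of size `T`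
from the hub model: the pairs `(z t, G t)` are independent over `t`, the hub `z t` is `i` with
probability `ρ i`, and given `z t = i` the nodes appear independently, node `j` with
probability `A i j`. -/
structure IsHubSample {nL n T : ℕ} (θ : HubParams nL n) {Ω : Type*} [MeasurableSpace Ω]
    (μ : Measure Ω) (z : Fin T → Ω → Fin nL) (G : Fin T → Ω → Fin n → Bool) : Prop where
  measurable_z : ∀ t, Measurable (z t)
  measurable_G : ∀ t, Measurable (G t)
  indep : iIndepFun (fun t ω => (z t ω, G t ω)) μ
  law : ∀ t i (g : Fin n → Bool),
    μ.real {ω | z t ω = i ∧ G t ω = g}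
      = θ.ρ i * ∏ j, (if g j = true then θ.A i j else 1 - θ.A i j)

/-- The number `t_i` of groups to which the assignment `z` gives the label `i`. -/
def hubCount {nL T : ℕ} (z : Fin T → Fin nL) (i : Fin nL) : ℕ :=
  (Finset.univ.filter fun t => z t = i).card

/-- The estimator `Â^z`: the frequency of node `j` among the groups labelled `i` by `z`
(it is only meaningful when there is such a group). -/
noncomputable def estA {nL n T : ℕ} (G : Fin T → Fin n → Bool) (z : Fin T → Fin nL)
    (i : Fin nL) (j : Fin n) : ℝ :=
  (∑ t, if G t j = true ∧ z t = i then (1 : ℝ) else 0) / (hubCount z i : ℝ)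

/-- The log-likelihood `L_G(A | z)` of the groups `G` given the labels `z`. -/
noncomputable def condLogLik {nL n T : ℕ} (G : Fin T → Fin n → Bool) (A : Fin nL → Fin n → ℝ)
    (z : Fin T → Fin nL) : ℝ :=
  ∑ t, ∑ j, if G t j = true then Real.log (A (z t) j) else Real.log (1 - A (z t) j)

/-- The profile log-likelihood `L_G(z)`, with `Â^z` plugged in. The logarithms that occur in it
are never taken at `0`. -/
noncomputable def profileLogLik {nL n T : ℕ} (G : Fin T → Fin n → Bool)
    (z : Fin T → Fin nL) : ℝ :=
  condLogLik G (estA G z) z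

/-- A label assignment is feasible if every group contains the hub assigned to it. As
`A i i = 1`, any other assignment has likelihood zero. -/
def Feasible {nL n T : ℕ} (h : nL ≤ n) (G : Fin T → Fin n → Bool) (z : Fin T → Fin nL) : Prop :=
  ∀ t, G t (Fin.castLE h (z t)) = true

/-- `z` is a maximum profile likelihood estimate of the hub labels. -/
def IsProfileMLE {nL n T : ℕ} (h : nL ≤ n) (G : Fin T → Fin n → Bool)
    (z : Fin T → Fin nL) : Prop :=
  Feasible h G z ∧ ∀ z' : Fin T → Fin nL, Feasible h G z' → profileLogLik G z' ≤ profileLogLik G z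

/-- For every hub `i` there is a set `V i` of at least `v n / nL` nodes which join the groups of
hub `i` with a probability larger by at least `d` than those of any other hub. -/
def HubsSeparated {nL n : ℕ} (θ : HubParams nL n) (d v : ℝ) : Prop :=
  ∃ V : Fin nL → Finset (Fin n), ∀ i,
    v * (n : ℝ) / (nL : ℝ) ≤ ((V i).card : ℝ) ∧
      ∀ j ∈ V i, ∀ i', i' ≠ i → d ≤ θ.A i j - θ.A i' j

/-- `max_{i,j} |Â^z_{ij} - A_{ij}|`. -/
noncomputable def maxError {nL n T : ℕ} (θ : HubParams nL n) (G : Fin T → Fin n → Bool)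
    (z : Fin T → Fin nL) : ℝ :=
  ⨆ p : Fin nL × Fin n, |estA G z p.1 p.2 - θ.A p.1 p.2|

/-- The probability that a Bernoulli variable with parameter `p` takes the value `b`. -/
def bern (p : ℝ) (b : Bool) : ℝ := if b = true then p else 1 - p

lemma bern_nonneg {p : ℝ} (h0 : 0 ≤ p) (h1 : p ≤ 1) (b : Bool) : 0 ≤ bern p b := by
  unfold bern; split_ifs <;> linarith

lemma sum_bern (p : ℝ) : ∑ b, bern p b = 1 := by
  simp [bern]

lemma sum_prod_bern {ι : Type*} [Fintype ι] [DecidableEq ι] (a : ι → ℝ) :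
    ∑ g : ι → Bool, ∏ j, bern (a j) (g j) = 1 := by
  rw [← Fintype.prod_sum (fun j b => bern (a j) b)]; simp only [sum_bern, Finset.prod_const_one]

/-- The joint probability of a hub and a membership vector in one group. -/
def hubWeight {nL n : ℕ} (θ : HubParams nL n) (y : Fin nL × (Fin n → Bool)) : ℝ :=
  θ.ρ y.1 * ∏ j, bern (θ.A y.1 j) (y.2 j)

lemma hubWeight_nonneg {nL n : ℕ} (θ : HubParams nL n) (y : Fin nL × (Fin n → Bool)) :
    0 ≤ hubWeight θ y :=
  mul_nonneg (θ.ρ_nonneg _) (Finset.prod_nonneg fun _ _ =>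
    bern_nonneg (θ.A_nonneg _ _) (θ.A_le_one _ _) _)

lemma sum_hubWeight {nL n : ℕ} (θ : HubParams nL n) : ∑ y, hubWeight θ y = 1 := by
  simp only [hubWeight, Fintype.sum_prod_type, ← Finset.mul_sum, sum_prod_bern, mul_one, θ.ρ_sum]

/-- The probability that a finite sample lies in `S` is the sum of the weights of its elements. -/
lemma IsHubSample.real_mem_eq {nL n T : ℕ} {θ : HubParams nL n} {Ω : Type*} [MeasurableSpace Ω]
    {μ : Measure Ω} [IsProbabilityMeasure μ] {z : Fin T → Ω → Fin nL}
    {G : Fin T → Ω → Fin n → Bool} (h : IsHubSample θ μ z G)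
    (S : Set (Fin T → Fin nL × (Fin n → Bool))) :
    μ.real {ω | (fun t => (z t ω, G t ω)) ∈ S}
      = ∑ x, S.indicator (fun x => ∏ t, hubWeight θ (x t)) x := by
  classical
  have hm : ∀ t, Measurable fun ω => (z t ω, G t ω) :=
    fun t => (h.measurable_z t).prodMk (h.measurable_G t)
  have hX : Measurable fun ω => fun t => (z t ω, G t ω) := measurable_pi_lambda _ hm
  have hs : ∀ x : Fin T → Fin nL × (Fin n → Bool),
      μ.real ((fun ω => fun t => (z t ω, G t ω)) ⁻¹' {x}) = ∏ t, hubWeight θ (x t) := by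
    intro x
    have h1 : ((fun ω => fun t => (z t ω, G t ω)) ⁻¹' {x})
        = ⋂ t ∈ (Finset.univ : Finset (Fin T)), (fun ω => (z t ω, G t ω)) ⁻¹' {x t} := by
      ext ω; simp [funext_iff]
    rw [h1, measureReal_def, h.indep.measure_inter_preimage_eq_mul Finset.univ
      (sets := fun t => {x t}) (fun t _ => measurableSet_singleton _), ENNReal.toReal_prod]
    refine Finset.prod_congr rfl fun t _ => ?_
    have h2 := h.law t (x t).1 (x t).2
    rw [measureReal_def] at h2
    simp only [hubWeight, bern]
    rw [← h2]
    congr 2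
    ext ω; simp [Prod.ext_iff]
  have h3 : {ω | (fun t => (z t ω, G t ω)) ∈ S}
      = ⋃ x ∈ (Finset.univ.filter (· ∈ S)), (fun ω => fun t => (z t ω, G t ω)) ⁻¹' {x} := by
    ext ω; simp
  rw [h3, measureReal_biUnion_finset]
  · simp only [hs, Finset.sum_filter, Set.indicator_apply]
  · intro x _ y _ hxy
    exact Disjoint.preimage _ (by simpa using hxy)
  · intro x _
    exact hX (measurableSet_singleton _)

lemma exp_le_one_add_add_sq {x : ℝ} (h : |x| ≤ 1) : Real.exp x ≤ 1 + x + x ^ 2 := by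
  have := (abs_le.1 (Real.abs_exp_sub_one_sub_id_le h)).2
  linarith

/-- A Bernstein type tail bound for sums over the groups of a sample. -/
lemma IsHubSample.real_le_sum_le {nL n T : ℕ} {θ : HubParams nL n} {Ω : Type*}
    [MeasurableSpace Ω] {μ : Measure Ω} [IsProbabilityMeasure μ] {z : Fin T → Ω → Fin nL}
    {G : Fin T → Ω → Fin n → Bool} (h : IsHubSample θ μ z G)
    (f : Fin nL × (Fin n → Bool) → ℝ) (hf : ∀ y, |f y| ≤ 1) {m σ a s : ℝ}
    (hm : ∑ y, hubWeight θ y * f y ≤ m) (hσ : ∑ y, hubWeight θ y * f y ^ 2 ≤ σ)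
    (hs0 : 0 ≤ s) (hs1 : s ≤ 1) :
    μ.real {ω | a ≤ ∑ t, f (z t ω, G t ω)} ≤ Real.exp (-s * a + T * (s * m + s ^ 2 * σ)) := by
  classical
  have h0 := h.real_mem_eq {x | a ≤ ∑ t, f (x t)}
  simp only [Set.mem_ofPred_eq] at h0
  rw [h0]
  have h1 : ∀ x : Fin T → Fin nL × (Fin n → Bool),
      Set.indicator {x | a ≤ ∑ t, f (x t)} (fun x => ∏ t, hubWeight θ (x t)) x
        ≤ Real.exp (-s * a) * ∏ t, (hubWeight θ (x t) * Real.exp (s * f (x t))) := by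
    intro x
    have hp : 0 ≤ ∏ t, hubWeight θ (x t) := Finset.prod_nonneg fun t _ => hubWeight_nonneg θ _
    rw [Finset.prod_mul_distrib, ← Real.exp_sum, ← Finset.mul_sum, mul_left_comm, ← Real.exp_add]
    by_cases hx : a ≤ ∑ t, f (x t)
    · rw [Set.indicator_of_mem (show x ∈ {x | a ≤ ∑ t, f (x t)} from hx)]
      refine le_mul_of_one_le_right hp (Real.one_le_exp ?_)
      nlinarith
    · rw [Set.indicator_of_notMem (show x ∉ {x | a ≤ ∑ t, f (x t)} from hx)]
      positivity
  refine (Finset.sum_le_sum fun x _ => h1 x).trans ?_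
  rw [← Finset.mul_sum, ← Fintype.prod_sum (fun _ y => hubWeight θ y * Real.exp (s * f y)),
    Finset.prod_const, Finset.card_univ, Fintype.card_fin, Real.exp_add, Real.exp_nat_mul]
  refine mul_le_mul_of_nonneg_left (pow_le_pow_left₀ (Finset.sum_nonneg fun y _ =>
    mul_nonneg (hubWeight_nonneg θ y) (Real.exp_pos _).le) ?_ T) (Real.exp_pos _).le
  calc ∑ y, hubWeight θ y * Real.exp (s * f y)
      ≤ ∑ y, (hubWeight θ y + s * (hubWeight θ y * f y) + s ^ 2 * (hubWeight θ y * f y ^ 2)) := by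
        refine Finset.sum_le_sum fun y _ => ?_
        have hb : |s * f y| ≤ 1 := by
          rw [abs_mul, abs_of_nonneg hs0]
          nlinarith [hf y, abs_nonneg (f y)]
        have := mul_le_mul_of_nonneg_left (exp_le_one_add_add_sq hb) (hubWeight_nonneg θ y)
        linarith
    _ = 1 + s * ∑ y, hubWeight θ y * f y + s ^ 2 * ∑ y, hubWeight θ y * f y ^ 2 := by
        rw [Finset.sum_add_distrib, Finset.sum_add_distrib, sum_hubWeight, Finset.mul_sum,
          Finset.mul_sum]
    _ ≤ 1 + s * m + s ^ 2 * σ := by gcongr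
    _ ≤ Real.exp (s * m + s ^ 2 * σ) := by
        have := Real.add_one_le_exp (s * m + s ^ 2 * σ)
        linarith

/-- The Bhattacharyya affinity of two Bernoulli laws. -/
lemma sum_sqrt_bern_mul_le {p q : ℝ} (hp0 : 0 ≤ p) (hp1 : p ≤ 1) (hq0 : 0 ≤ q) (hq1 : q ≤ 1) :
    ∑ b, √(bern p b * bern q b) ≤ Real.exp (-(p - q) ^ 2 / 4) := by
  have key : ∀ x y : ℝ, 0 ≤ x → x ≤ 1 → 0 ≤ y → y ≤ 1 →
      √(x * y) ≤ (x + y) / 2 - (x - y) ^ 2 / 8 := by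
    intro x y hx0 hx1 hy0 hy1
    rw [Real.sqrt_mul hx0]
    have hx := Real.sq_sqrt hx0
    have hy := Real.sq_sqrt hy0
    have hx' := Real.sqrt_le_one.2 hx1
    have hy' := Real.sqrt_le_one.2 hy1
    have hx2 := Real.sqrt_nonneg x
    have hy2 := Real.sqrt_nonneg y
    generalize √x = u at *
    generalize √y = w at *
    subst hx hy
    have h4 : (u + w) ^ 2 ≤ 4 := by nlinarith
    have h5 := mul_le_mul_of_nonneg_left h4 (sq_nonneg (u - w))
    nlinarith
  have h1 := key p q hp0 hp1 hq0 hq1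
  have h2 := key (1 - p) (1 - q) (by linarith) (by linarith) (by linarith) (by linarith)
  have h3 := Real.add_one_le_exp (-(p - q) ^ 2 / 4)
  simp only [Fintype.sum_bool, bern, if_true, Bool.false_eq_true, if_false]
  nlinarith

/-- The likelihood of the groups `g` under the connection probabilities `B` and the labels `w`. -/
def lik {nL n T : ℕ} (g : Fin T → Fin n → Bool) (B : Fin nL → Fin n → ℝ) (w : Fin T → Fin nL) :
    ℝ :=
  ∏ t, ∏ j, bern (B (w t) j) (g t j)

lemma lik_nonneg {nL n T : ℕ} (g : Fin T → Fin n → Bool) {B : Fin nL → Fin n → ℝ}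
    (h0 : ∀ i j, 0 ≤ B i j) (h1 : ∀ i j, B i j ≤ 1) (w : Fin T → Fin nL) : 0 ≤ lik g B w :=
  Finset.prod_nonneg fun _ _ => Finset.prod_nonneg fun _ _ => bern_nonneg (h0 _ _) (h1 _ _) _

/-- The probability, under `A` and `w`, that the likelihood at `B` and `z` is not smaller than
the one at `A` and `w`. -/
lemma sum_lik_le {nL n T : ℕ} {A B : Fin nL → Fin n → ℝ} (hA0 : ∀ i j, 0 ≤ A i j)
    (hA1 : ∀ i j, A i j ≤ 1) (hB0 : ∀ i j, 0 ≤ B i j) (hB1 : ∀ i j, B i j ≤ 1)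
    (w z : Fin T → Fin nL) :
    ∑ g : Fin T → Fin n → Bool, (if lik g A w ≤ lik g B z then lik g A w else 0)
      ≤ Real.exp (-(∑ t, ∑ j, (A (w t) j - B (z t) j) ^ 2) / 4) := by
  classical
  have h1 : ∀ g : Fin T → Fin n → Bool, (if lik g A w ≤ lik g B z then lik g A w else 0)
      ≤ ∏ t, ∏ j, √(bern (A (w t) j) (g t j) * bern (B (z t) j) (g t j)) := by
    intro g
    have hb : ∀ t j, 0 ≤ bern (A (w t) j) (g t j) * bern (B (z t) j) (g t j) := fun t j =>
      mul_nonneg (bern_nonneg (hA0 _ _) (hA1 _ _) _) (bern_nonneg (hB0 _ _) (hB1 _ _) _)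
    split_ifs with h
    · have h2 : (∏ t, ∏ j, √(bern (A (w t) j) (g t j) * bern (B (z t) j) (g t j))) ^ 2
          = lik g A w * lik g B z := by
        simp only [lik, ← Finset.prod_pow, ← Finset.prod_mul_distrib, Real.sq_sqrt (hb _ _)]
      refine le_of_sq_le_sq ?_ (Finset.prod_nonneg fun _ _ => Finset.prod_nonneg fun _ _ =>
        Real.sqrt_nonneg _)
      rw [h2, sq]
      exact mul_le_mul_of_nonneg_left h (lik_nonneg g hA0 hA1 w)
    · exact Finset.prod_nonneg fun _ _ => Finset.prod_nonneg fun _ _ => Real.sqrt_nonneg _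
  refine (Finset.sum_le_sum fun g _ => h1 g).trans ?_
  rw [← Fintype.prod_sum
    (fun t (u : Fin n → Bool) => ∏ j, √(bern (A (w t) j) (u j) * bern (B (z t) j) (u j))),
    neg_div, Finset.sum_div, ← Finset.sum_neg_distrib, Real.exp_sum]
  refine Finset.prod_le_prod (fun _ _ => Finset.sum_nonneg fun _ _ => Finset.prod_nonneg
    fun _ _ => Real.sqrt_nonneg _) fun t _ => ?_
  rw [← Fintype.prod_sum
    (fun j b => √(bern (A (w t) j) b * bern (B (z t) j) b)),
    Finset.sum_div, ← Finset.sum_neg_distrib, Real.exp_sum]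
  refine Finset.prod_le_prod (fun _ _ => Finset.sum_nonneg fun _ _ => Real.sqrt_nonneg _)
    fun j _ => ?_
  rw [← neg_div]
  exact sum_sqrt_bern_mul_le (hA0 _ _) (hA1 _ _) (hB0 _ _) (hB1 _ _)

lemma IsHubSample.real_lik_le_lik_le {nL n T : ℕ} {θ : HubParams nL n} {Ω : Type*}
    [MeasurableSpace Ω] {μ : Measure Ω} [IsProbabilityMeasure μ] {z : Fin T → Ω → Fin nL}
    {G : Fin T → Ω → Fin n → Bool} (h : IsHubSample θ μ z G)
    {B : Fin nL → Fin n → ℝ} (hB0 : ∀ i j, 0 ≤ B i j) (hB1 : ∀ i j, B i j ≤ 1)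
    (z' : Fin T → Fin nL) (R : (Fin T → Fin nL) → Prop) {E : ℝ}
    (hE : ∀ w, R w → E ≤ ∑ t, ∑ j, (θ.A (w t) j - B (z' t) j) ^ 2) :
    μ.real {ω | R (fun t => z t ω) ∧
        lik (fun t => G t ω) θ.A (fun t => z t ω) ≤ lik (fun t => G t ω) B z'}
      ≤ Real.exp (-E / 4) := by
  classical
  have h0 := h.real_mem_eq {x | R (fun t => (x t).1) ∧
    lik (fun t => (x t).2) θ.A (fun t => (x t).1) ≤ lik (fun t => (x t).2) B z'}
  simp only [Set.mem_ofPred_eq] at h0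
  rw [h0, ← (Equiv.arrowProdEquivProdArrow (Fin T) (fun _ => Fin nL)
    (fun _ => Fin n → Bool)).symm.sum_comp, Fintype.sum_prod_type]
  have h1 : ∀ w : Fin T → Fin nL, ∑ g : Fin T → Fin n → Bool,
      Set.indicator {x : Fin T → Fin nL × (Fin n → Bool) | R (fun t => (x t).1) ∧
        lik (fun t => (x t).2) θ.A (fun t => (x t).1) ≤ lik (fun t => (x t).2) B z'}
        (fun x => ∏ t, hubWeight θ (x t))
        ((Equiv.arrowProdEquivProdArrow (Fin T) (fun _ => Fin nL)
          (fun _ => Fin n → Bool)).symm (w, g))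
      ≤ (∏ t, θ.ρ (w t)) * Real.exp (-E / 4) := by
    intro w
    have hρ : 0 ≤ ∏ t, θ.ρ (w t) := Finset.prod_nonneg fun _ _ => θ.ρ_nonneg _
    by_cases hw : R w
    · have h2 := sum_lik_le θ.A_nonneg θ.A_le_one hB0 hB1 w z'
      have h3 : Real.exp (-(∑ t, ∑ j, (θ.A (w t) j - B (z' t) j) ^ 2) / 4)
          ≤ Real.exp (-E / 4) := by
        have := hE w hw
        gcongr
      refine le_trans (le_of_eq ?_) (mul_le_mul_of_nonneg_left (h2.trans h3) hρ)
      rw [Finset.mul_sum]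
      refine Finset.sum_congr rfl fun g _ => ?_
      by_cases hl : lik g θ.A w ≤ lik g B z'
      · rw [if_pos hl, Set.indicator_of_mem (by exact ⟨hw, hl⟩)]
        simp [hubWeight, Finset.prod_mul_distrib, lik, Equiv.arrowProdEquivProdArrow]
      · rw [if_neg hl, mul_zero, Set.indicator_of_notMem (by exact fun hx => hl hx.2)]
    · refine le_trans (le_of_eq (Finset.sum_eq_zero fun g _ => ?_))
        (mul_nonneg hρ (Real.exp_pos _).le)
      simp [hw, Equiv.arrowProdEquivProdArrow]
  refine (Finset.sum_le_sum fun w _ => h1 w).trans ?_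
  rw [← Finset.sum_mul, ← Fintype.prod_sum (fun _ i => θ.ρ i)]
  simp [θ.ρ_sum]

lemma sum_ite_eq_card {nL n T : ℕ} (g : Fin T → Fin n → Bool) (z : Fin T → Fin nL)
    (i : Fin nL) (j : Fin n) :
    (∑ t, if g t j = true ∧ z t = i then (1 : ℝ) else 0)
      = ((Finset.univ.filter fun t => g t j = true ∧ z t = i).card : ℝ) := by
  simp

lemma card_le_hubCount {nL n T : ℕ} (g : Fin T → Fin n → Bool) (z : Fin T → Fin nL)
    (i : Fin nL) (j : Fin n) :
    (Finset.univ.filter fun t => g t j = true ∧ z t = i).card ≤ hubCount z i := by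
  refine Finset.card_le_card fun t => ?_
  simp only [Finset.mem_filter]
  tauto

lemma estA_nonneg {nL n T : ℕ} (g : Fin T → Fin n → Bool) (z : Fin T → Fin nL)
    (i : Fin nL) (j : Fin n) : 0 ≤ estA g z i j := by
  rw [estA, sum_ite_eq_card]; positivity

lemma estA_le_one {nL n T : ℕ} (g : Fin T → Fin n → Bool) (z : Fin T → Fin nL)
    (i : Fin nL) (j : Fin n) : estA g z i j ≤ 1 := by
  rw [estA, sum_ite_eq_card]
  exact div_le_one_of_le₀ (by exact_mod_cast card_le_hubCount g z i j) (by positivity)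

/-- A union bound over all label assignments and all values of the estimator. -/
lemma IsHubSample.real_exists_lik_le {nL n T : ℕ} {θ : HubParams nL n} {Ω : Type*}
    [MeasurableSpace Ω] {μ : Measure Ω} [IsProbabilityMeasure μ] {z : Fin T → Ω → Fin nL}
    {G : Fin T → Ω → Fin n → Bool} (h : IsHubSample θ μ z G)
    (R : (Fin T → Fin nL) → (Fin T → Fin nL) → Prop) {E : ℝ}
    (hE : ∀ w z' (B : Fin nL → Fin n → ℝ), R w z' →
      E ≤ ∑ t, ∑ j, (θ.A (w t) j - B (z' t) j) ^ 2) :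
    μ.real {ω | ∃ z', R (fun t => z t ω) z' ∧ lik (fun t => G t ω) θ.A (fun t => z t ω)
        ≤ lik (fun t => G t ω) (estA (fun t => G t ω) z') z'}
      ≤ (nL : ℝ) ^ T * ((T : ℝ) + 1) ^ (n * nL) * Real.exp (-E / 4) := by
  classical
  obtain ⟨B, hBdef⟩ : ∃ B : (Fin T → Fin nL) → (Fin nL → Fin n → Fin (T + 1)) →
      Fin nL → Fin n → ℝ, ∀ z' c i j, B z' c i j
        = min 1 ((c i j : ℕ) / (hubCount z' i : ℝ)) :=
    ⟨fun z' c i j => min 1 ((c i j : ℕ) / (hubCount z' i : ℝ)), fun _ _ _ _ => rfl⟩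
  have hsub : {ω | ∃ z', R (fun t => z t ω) z' ∧ lik (fun t => G t ω) θ.A (fun t => z t ω)
        ≤ lik (fun t => G t ω) (estA (fun t => G t ω) z') z'}
      ⊆ ⋃ p : (Fin T → Fin nL) × (Fin nL → Fin n → Fin (T + 1)),
        {ω | R (fun t => z t ω) p.1 ∧ lik (fun t => G t ω) θ.A (fun t => z t ω)
          ≤ lik (fun t => G t ω) (B p.1 p.2) p.1} := by
    rintro ω ⟨z', hR, hl⟩
    have hc : ∀ i j, (Finset.univ.filter fun t => G t ω j = true ∧ z' t = i).card < T + 1 :=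
      fun i j => Nat.lt_succ_of_le ((Finset.card_le_univ _).trans (Fintype.card_fin T).le)
    have hB : B z' (fun i j => ⟨_, hc i j⟩) = estA (fun t => G t ω) z' := by
      funext i j
      have h1 := estA_le_one (fun t => G t ω) z' i j
      rw [estA, sum_ite_eq_card] at h1 ⊢
      rw [hBdef]
      exact min_eq_right h1
    rw [← hB] at hl
    exact Set.mem_iUnion.2 ⟨(z', fun i j => ⟨_, hc i j⟩), ⟨hR, hl⟩⟩
  have hp : ∀ p : (Fin T → Fin nL) × (Fin nL → Fin n → Fin (T + 1)),
      μ.real {ω | R (fun t => z t ω) p.1 ∧ lik (fun t => G t ω) θ.A (fun t => z t ω)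
          ≤ lik (fun t => G t ω) (B p.1 p.2) p.1} ≤ Real.exp (-E / 4) := by
    intro p
    refine h.real_lik_le_lik_le (B := B p.1 p.2) (fun i j => ?_) (fun i j => ?_) p.1
      (fun w => R w p.1) (E := E) fun w hw => hE w p.1 _ hw
    · rw [hBdef]
      exact le_min zero_le_one (by positivity)
    · rw [hBdef]
      exact min_le_left _ _
  have hcard : Fintype.card ((Fin T → Fin nL) × (Fin nL → Fin n → Fin (T + 1)))
      = nL ^ T * (T + 1) ^ (n * nL) := by
    simp only [Fintype.card_prod, Fintype.card_fun, Fintype.card_fin, pow_mul]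
  refine (measureReal_mono hsub).trans ((measureReal_iUnion_fintype_le _).trans ?_)
  refine (Finset.sum_le_sum fun p _ => hp p).trans (le_of_eq ?_)
  rw [Finset.sum_const, Finset.card_univ, hcard, nsmul_eq_mul]
  push_cast
  ring

lemma bern_estA_pos {nL n T : ℕ} (g : Fin T → Fin n → Bool) (z : Fin T → Fin nL) (t : Fin T)
    (j : Fin n) : 0 < bern (estA g z (z t) j) (g t j) := by
  have hpos : 0 < hubCount z (z t) := Finset.card_pos.2 ⟨t, by simp⟩
  unfold bern
  rw [estA, sum_ite_eq_card]
  split_ifs with h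
  · have : 0 < (Finset.univ.filter fun t' => g t' j = true ∧ z t' = z t).card :=
      Finset.card_pos.2 ⟨t, by simp [h]⟩
    positivity
  · have : (Finset.univ.filter fun t' => g t' j = true ∧ z t' = z t).card < hubCount z (z t) := by
      refine Finset.card_lt_card ⟨fun t' => ?_, fun hs => ?_⟩
      · simp only [Finset.mem_filter]; tauto
      · have := hs (show t ∈ _ from Finset.mem_filter.2 ⟨Finset.mem_univ t, rfl⟩)
        simp [h] at this
    rw [sub_pos, div_lt_one (by positivity)]
    exact_mod_cast this

lemma condLogLik_eq_log_lik {nL n T : ℕ} {g : Fin T → Fin n → Bool} {B : Fin nL → Fin n → ℝ}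
    {w : Fin T → Fin nL} (h : ∀ t j, bern (B (w t) j) (g t j) ≠ 0) :
    condLogLik g B w = Real.log (lik g B w) := by
  unfold lik condLogLik
  rw [Real.log_prod fun t _ => Finset.prod_ne_zero_iff.2 fun j _ => h t j]
  refine Finset.sum_congr rfl fun t _ => ?_
  rw [Real.log_prod fun j _ => h t j]
  refine Finset.sum_congr rfl fun j _ => ?_
  unfold bern
  split_ifs <;> rfl

lemma sum_bern_div_bern_estA_le {nL n T : ℕ} (g : Fin T → Fin n → Bool) {A : Fin nL → Fin n → ℝ}
    (h0 : ∀ i j, 0 ≤ A i j) (h1 : ∀ i j, A i j ≤ 1) (w : Fin T → Fin nL) (j : Fin n) :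
    ∑ t, (bern (A (w t) j) (g t j) / bern (estA g w (w t) j) (g t j) - 1) ≤ 0 := by
  classical
  rw [← Finset.sum_fiberwise Finset.univ w]
  refine Finset.sum_nonpos fun i _ => ?_
  have e1 : ∑ t ∈ Finset.univ.filter (fun t => w t = i),
      (bern (A (w t) j) (g t j) / bern (estA g w (w t) j) (g t j) - 1)
      = ∑ t ∈ Finset.univ.filter (fun t => w t = i),
        ((if g t j = true then A i j / estA g w i j else (1 - A i j) / (1 - estA g w i j)) - 1) := by
    refine Finset.sum_congr rfl fun t ht => ?_
    rw [(Finset.mem_filter.1 ht).2]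
    unfold bern
    split_ifs <;> rfl
  rw [e1, Finset.sum_sub_distrib, Finset.sum_ite, Finset.sum_const, Finset.sum_const,
    Finset.sum_const, Finset.filter_filter, Finset.filter_filter]
  have hsplit := Finset.card_filter_add_card_filter_not (s := Finset.univ.filter fun t => w t = i)
    (fun t => g t j = true)
  rw [Finset.filter_filter, Finset.filter_filter] at hsplit
  have hk : (Finset.univ.filter fun t => g t j = true ∧ w t = i)
      = Finset.univ.filter fun t => w t = i ∧ g t j = true := by
    ext; simp [and_comm]
  rw [estA, sum_ite_eq_card, hk, hubCount]
  generalize (Finset.univ.filter fun t => w t = i ∧ g t j = true).card = k at *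
  generalize (Finset.univ.filter fun t => w t = i ∧ ¬ g t j = true).card = l at *
  generalize (Finset.univ.filter fun t => w t = i).card = m at *
  subst hsplit
  simp only [nsmul_eq_mul, Nat.cast_add, mul_one]
  have hA0 := h0 i j
  have hA1 := h1 i j
  have e2 : (k : ℝ) * (A i j / ((k : ℝ) / (k + l))) ≤ (k + l) * A i j := by
    rcases Nat.eq_zero_or_pos k with rfl | hk
    · simp; positivity
    · apply le_of_eq; field_simp
  have e3 : (l : ℝ) * ((1 - A i j) / (1 - (k : ℝ) / (k + l))) ≤ (k + l) * (1 - A i j) := by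
    rcases Nat.eq_zero_or_pos l with rfl | hl
    · simp; nlinarith [(Nat.cast_nonneg k : (0 : ℝ) ≤ k)]
    · have hkl : (0 : ℝ) < k + l := by positivity
      have : 1 - (k : ℝ) / (k + l) = l / (k + l) := by field_simp; ring
      rw [this]
      apply le_of_eq; field_simp
  linarith

/-- The estimator maximizes the likelihood for given labels. -/
lemma condLogLik_le_profileLogLik {nL n T : ℕ} {g : Fin T → Fin n → Bool}
    {A : Fin nL → Fin n → ℝ} (h0 : ∀ i j, 0 ≤ A i j) (h1 : ∀ i j, A i j ≤ 1)
    {w : Fin T → Fin nL} (hw : lik g A w ≠ 0) : condLogLik g A w ≤ profileLogLik g w := by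
  have hne : ∀ t j, bern (A (w t) j) (g t j) ≠ 0 := fun t j =>
    Finset.prod_ne_zero_iff.1 (Finset.prod_ne_zero_iff.1 hw t (Finset.mem_univ t)) j
      (Finset.mem_univ j)
  have hterm : ∀ t j, (if g t j = true then Real.log (A (w t) j) else Real.log (1 - A (w t) j))
      ≤ (if g t j = true then Real.log (estA g w (w t) j) else Real.log (1 - estA g w (w t) j))
        + (bern (A (w t) j) (g t j) / bern (estA g w (w t) j) (g t j) - 1) := by
    intro t j
    have e : ∀ p, (if g t j = true then Real.log p else Real.log (1 - p))
        = Real.log (bern p (g t j)) := by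
      intro p; unfold bern; split_ifs <;> rfl
    rw [e, e]
    have hp : 0 < bern (A (w t) j) (g t j) :=
      lt_of_le_of_ne (bern_nonneg (h0 _ _) (h1 _ _) _) (hne t j).symm
    have hq := bern_estA_pos g w t j
    have := Real.log_le_sub_one_of_pos (div_pos hp hq)
    rw [Real.log_div hp.ne' hq.ne'] at this
    linarith
  have hsum : ∑ t, ∑ j, (bern (A (w t) j) (g t j) / bern (estA g w (w t) j) (g t j) - 1) ≤ 0 := by
    rw [Finset.sum_comm]
    exact Finset.sum_nonpos fun j _ => sum_bern_div_bern_estA_le g h0 h1 w j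
  have := Finset.sum_le_sum fun t (_ : t ∈ Finset.univ) =>
    Finset.sum_le_sum fun j (_ : j ∈ Finset.univ) => hterm t j
  simp only [Finset.sum_add_distrib] at this
  unfold profileLogLik condLogLik
  linarith

/-- The likelihood at the estimates is at least the likelihood at the true parameters. -/
lemma IsProfileMLE.lik_le {nL n T : ℕ} {h : nL ≤ n} {g : Fin T → Fin n → Bool}
    {z : Fin T → Fin nL} (hz : IsProfileMLE h g z) {A : Fin nL → Fin n → ℝ}
    (h0 : ∀ i j, 0 ≤ A i j) (h1 : ∀ i j, A i j ≤ 1) {w : Fin T → Fin nL} (hf : Feasible h g w)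
    (hw : lik g A w ≠ 0) : lik g A w ≤ lik g (estA g z) z := by
  have hne : ∀ t j, bern (A (w t) j) (g t j) ≠ 0 := fun t j =>
    Finset.prod_ne_zero_iff.1 (Finset.prod_ne_zero_iff.1 hw t (Finset.mem_univ t)) j
      (Finset.mem_univ j)
  have hA : 0 < lik g A w := lt_of_le_of_ne (lik_nonneg g h0 h1 w) hw.symm
  have hE : 0 < lik g (estA g z) z :=
    Finset.prod_pos fun t _ => Finset.prod_pos fun j _ => bern_estA_pos g z t j
  rw [← Real.log_le_log_iff hA hE, ← condLogLik_eq_log_lik hne,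
    ← condLogLik_eq_log_lik fun t j => (bern_estA_pos g z t j).ne']
  exact (condLogLik_le_profileLogLik h0 h1 hw).trans (hz.2 w hf)

/-- The number of groups on which two label assignments disagree. -/
def labelErr {nL T : ℕ} (w z : Fin T → Fin nL) : ℕ :=
  (Finset.univ.filter fun t => w t ≠ z t).card

lemma mul_sq_add_mul_sq_ge {a c x y d κ : ℝ} (ha : 0 ≤ a) (hc : 0 ≤ c) (hd : 0 ≤ d)
    (hxy : d ≤ x - y) (hκ : κ * (a + c) ≤ c) : κ * d ^ 2 * a ≤ a * x ^ 2 + c * y ^ 2 := by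
  rcases (add_nonneg ha hc).eq_or_lt with h | h
  · have ha0 : a = 0 := by linarith
    have hc0 : c = 0 := by linarith
    simp [ha0, hc0]
  · have h1 : a * c * (x - y) ^ 2 ≤ (a + c) * (a * x ^ 2 + c * y ^ 2) := by
      nlinarith [sq_nonneg (a * x + c * y)]
    have h2 : d ^ 2 ≤ (x - y) ^ 2 := pow_le_pow_left₀ hd hxy 2
    have h3 : κ * (a + c) * (a * d ^ 2) ≤ c * (a * d ^ 2) :=
      mul_le_mul_of_nonneg_right hκ (by positivity)
    have h4 : a * c * d ^ 2 ≤ a * c * (x - y) ^ 2 :=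
      mul_le_mul_of_nonneg_left h2 (by positivity)
    refine le_of_mul_le_mul_left ?_ h
    linarith

/-- A node which separates hub `i` from the other hubs contributes to the distance between the
two assignments proportionally to the number of groups of hub `i` with a wrong label. -/
lemma sum_sq_sub_ge_of_separating {nL n T : ℕ} {θ : HubParams nL n} {d κ : ℝ} (hd : 0 ≤ d)
    {w z : Fin T → Fin nL}
    (hκ : ∀ k, κ * hubCount z k ≤ (Finset.univ.filter fun t => w t = k ∧ z t = k).card)
    (hκ0 : 0 ≤ κ) {i : Fin nL} {j : Fin n} (hj : ∀ i', i' ≠ i → d ≤ θ.A i j - θ.A i' j)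
    (B : Fin nL → Fin n → ℝ) :
    κ * d ^ 2 * (Finset.univ.filter fun t => w t = i ∧ z t ≠ i).card
      ≤ ∑ t, (θ.A (w t) j - B (z t) j) ^ 2 := by
  classical
  rw [← Finset.sum_fiberwise Finset.univ z, Finset.card_eq_sum_card_fiberwise
    (f := z) (t := Finset.univ) (fun _ _ => Finset.mem_coe.2 (Finset.mem_univ _)),
    Nat.cast_sum, Finset.mul_sum]
  refine Finset.sum_le_sum fun k _ => ?_
  rcases eq_or_ne k i with rfl | hki
  · have : Finset.filter (fun t => z t = k) (Finset.univ.filter fun t => w t = k ∧ z t ≠ k)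
        = ∅ := by
      ext t; simp
    rw [this]
    simpa using Finset.sum_nonneg fun t _ => sq_nonneg _
  · have e1 : Finset.filter (fun t => z t = k) (Finset.univ.filter fun t => w t = i ∧ z t ≠ i)
        = Finset.univ.filter fun t => w t = i ∧ z t = k := by
      ext t
      simp only [Finset.mem_filter, Finset.mem_univ, true_and]
      constructor
      · tauto
      · rintro ⟨h1, h2⟩; exact ⟨⟨h1, by rw [h2]; exact hki⟩, h2⟩
    rw [e1]
    have hdisj : Disjoint (Finset.univ.filter fun t => w t = i ∧ z t = k)
        (Finset.univ.filter fun t => w t = k ∧ z t = k) := by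
      rw [Finset.disjoint_filter]
      rintro t _ ⟨h1, -⟩ ⟨h2, -⟩
      exact hki (h2.symm.trans h1)
    have hsub : (Finset.univ.filter fun t => w t = i ∧ z t = k) ∪
        (Finset.univ.filter fun t => w t = k ∧ z t = k) ⊆ Finset.univ.filter fun t => z t = k := by
      intro t; simp; tauto
    have hcard : ((Finset.univ.filter fun t => w t = i ∧ z t = k).card : ℝ)
        + (Finset.univ.filter fun t => w t = k ∧ z t = k).card ≤ hubCount z k := by
      rw [← Nat.cast_add, ← Finset.card_union_of_disjoint hdisj]
      exact_mod_cast Finset.card_le_card hsub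
    refine le_trans ?_ (Finset.sum_le_sum_of_subset_of_nonneg hsub fun _ _ _ => sq_nonneg _)
    rw [Finset.sum_union hdisj]
    have e2 : ∀ i', ∑ t ∈ Finset.univ.filter (fun t => w t = i' ∧ z t = k),
        (θ.A (w t) j - B (z t) j) ^ 2
        = (Finset.univ.filter fun t => w t = i' ∧ z t = k).card * (θ.A i' j - B k j) ^ 2 := by
      intro i'
      rw [← nsmul_eq_mul, ← Finset.sum_const]
      refine Finset.sum_congr rfl fun t ht => ?_
      obtain ⟨h1, h2⟩ := (Finset.mem_filter.1 ht).2
      rw [h1, h2]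
    rw [e2, e2]
    refine mul_sq_add_mul_sq_ge (Nat.cast_nonneg _) (Nat.cast_nonneg _) hd ?_ ?_
    · have := hj k hki
      linarith
    · exact (mul_le_mul_of_nonneg_left hcard hκ0).trans (hκ k)

lemma sum_sum_sq_sub_ge {nL n T : ℕ} {θ : HubParams nL n} {d v κ : ℝ} (hd : 0 < d)
    (hsep : HubsSeparated θ d v) {w z : Fin T → Fin nL}
    (hκ : ∀ k, κ * hubCount z k ≤ (Finset.univ.filter fun t => w t = k ∧ z t = k).card)
    (hκ0 : 0 ≤ κ) (B : Fin nL → Fin n → ℝ) :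
    κ * d ^ 2 * (v * n / nL) * labelErr w z ≤ ∑ t, ∑ j, (θ.A (w t) j - B (z t) j) ^ 2 := by
  classical
  obtain ⟨V, hV⟩ := hsep
  have hdisj : Set.PairwiseDisjoint (Finset.univ : Finset (Fin nL)) V := by
    intro i _ i' _ hii
    refine Finset.disjoint_left.2 fun j hj hj' => ?_
    have h1 := (hV i).2 j hj i' hii.symm
    have h2 := (hV i').2 j hj' i hii
    linarith
  have herr : labelErr w z = ∑ i, (Finset.univ.filter fun t => w t = i ∧ z t ≠ i).card := by
    rw [labelErr, Finset.card_eq_sum_card_fiberwise (f := w) (t := Finset.univ)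
      (fun _ _ => Finset.mem_coe.2 (Finset.mem_univ _))]
    refine Finset.sum_congr rfl fun i _ => congrArg _ ?_
    ext t
    simp only [Finset.mem_filter, Finset.mem_univ, true_and]
    constructor
    · rintro ⟨h1, h2⟩; exact ⟨h2, fun h3 => h1 (h2.trans h3.symm)⟩
    · rintro ⟨h1, h2⟩; exact ⟨fun h3 => h2 (h3.symm.trans h1), h1⟩
  rw [Finset.sum_comm]
  calc κ * d ^ 2 * (v * n / nL) * labelErr w z
      = ∑ i, (v * n / nL) * (κ * d ^ 2 *
          (Finset.univ.filter fun t => w t = i ∧ z t ≠ i).card) := by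
        rw [herr, Nat.cast_sum, Finset.mul_sum]
        exact Finset.sum_congr rfl fun i _ => by ring
    _ ≤ ∑ i, ((V i).card : ℝ) * (κ * d ^ 2 *
          (Finset.univ.filter fun t => w t = i ∧ z t ≠ i).card) :=
        Finset.sum_le_sum fun i _ => mul_le_mul_of_nonneg_right (hV i).1 (by positivity)
    _ ≤ ∑ i, ∑ j ∈ V i, ∑ t, (θ.A (w t) j - B (z t) j) ^ 2 := by
        refine Finset.sum_le_sum fun i _ => ?_
        rw [← nsmul_eq_mul]
        exact Finset.card_nsmul_le_sum _ _ _ fun j hj =>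
          sum_sq_sub_ge_of_separating hd.le hκ hκ0 ((hV i).2 j hj) B
    _ = ∑ j ∈ Finset.univ.biUnion V, ∑ t, (θ.A (w t) j - B (z t) j) ^ 2 :=
        (Finset.sum_biUnion hdisj).symm
    _ ≤ ∑ j, ∑ t, (θ.A (w t) j - B (z t) j) ^ 2 :=
        Finset.sum_le_sum_of_subset_of_nonneg (Finset.subset_univ _)
          fun _ _ _ => Finset.sum_nonneg fun _ _ => sq_nonneg _

lemma abs_hubCount_sub_le {nL T : ℕ} (w z : Fin T → Fin nL) (i : Fin nL) :
    |(hubCount z i : ℝ) - hubCount w i| ≤ labelErr w z := by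
  classical
  have e : ∀ u : Fin T → Fin nL, (hubCount u i : ℝ) = ∑ t, if u t = i then (1 : ℝ) else 0 := by
    intro u; simp [hubCount]
  have e' : (labelErr w z : ℝ) = ∑ t, if w t ≠ z t then (1 : ℝ) else 0 := by
    rw [labelErr, Finset.sum_boole]
  rw [e, e, e', ← Finset.sum_sub_distrib]
  refine (Finset.abs_sum_le_sum_abs _ _).trans (Finset.sum_le_sum fun t _ => ?_)
  by_cases h : w t = z t
  · simp [h]
  · rw [if_pos h]
    split_ifs <;> simp

lemma abs_sum_sub_sum_le {nL n T : ℕ} (g : Fin T → Fin n → Bool) (w z : Fin T → Fin nL)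
    (i : Fin nL) (j : Fin n) :
    |(∑ t, if g t j = true ∧ z t = i then (1 : ℝ) else 0)
      - ∑ t, if g t j = true ∧ w t = i then (1 : ℝ) else 0| ≤ labelErr w z := by
  classical
  have e' : (labelErr w z : ℝ) = ∑ t, if w t ≠ z t then (1 : ℝ) else 0 := by
    rw [labelErr, Finset.sum_boole]
  rw [e', ← Finset.sum_sub_distrib]
  refine (Finset.abs_sum_le_sum_abs _ _).trans (Finset.sum_le_sum fun t _ => ?_)
  by_cases h : w t = z t
  · simp [h]
  · rw [if_pos h]
    split_ifs <;> simp

/-- The deviation of the estimator in terms of the label errors and of the deviation for the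
true labels. -/
lemma abs_estA_sub_le {nL n T : ℕ} (g : Fin T → Fin n → Bool) (w z : Fin T → Fin nL)
    (i : Fin nL) (j : Fin n) (p : ℝ) (hw : 0 < hubCount w i) :
    |estA g z i j - p| ≤ (2 * labelErr w z
      + |∑ t, if w t = i then (if g t j = true then (1 : ℝ) else 0) - p else 0|) / hubCount w i := by
  have hm : (0 : ℝ) < hubCount w i := by exact_mod_cast hw
  have hdev : (∑ t, if w t = i then (if g t j = true then (1 : ℝ) else 0) - p else 0)
      = (∑ t, if g t j = true ∧ w t = i then (1 : ℝ) else 0) - p * hubCount w i := by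
    have : (hubCount w i : ℝ) = ∑ t, if w t = i then (1 : ℝ) else 0 := by simp [hubCount]
    rw [this, Finset.mul_sum, ← Finset.sum_sub_distrib]
    refine Finset.sum_congr rfl fun t _ => ?_
    by_cases h1 : w t = i <;> by_cases h2 : g t j = true <;> simp [h1, h2]
  have h1 := abs_sum_sub_sum_le g w z i j
  have h2 := abs_hubCount_sub_le w z i
  rw [hdev]
  have hest : estA g z i j * hubCount z i
      = ∑ t, if g t j = true ∧ z t = i then (1 : ℝ) else 0 := by
    by_cases h0 : hubCount z i = 0
    · have h3 := card_le_hubCount g z i j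
      rw [h0] at h3
      rw [sum_ite_eq_card, h0, Nat.le_zero.1 h3]
      simp
    · rw [estA, div_mul_cancel₀]
      exact_mod_cast h0
  rw [← hest] at h1
  generalize (∑ t, if g t j = true ∧ w t = i then (1 : ℝ) else 0) = s at *
  have he0 := estA_nonneg g z i j
  have he1 := estA_le_one g z i j
  generalize estA g z i j = e at *
  rw [le_div_iff₀ hm]
  have h3 : |e * (hubCount w i - hubCount z i)| ≤ labelErr w z := by
    rw [abs_mul, abs_of_nonneg he0, abs_sub_comm]
    nlinarith [abs_nonneg ((hubCount z i : ℝ) - hubCount w i)]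
  calc |e - p| * hubCount w i = |(e - p) * hubCount w i| := by
        rw [abs_mul, abs_of_pos hm]
    _ = |e * (hubCount w i - hubCount z i) + ((e * hubCount z i - s)
          + (s - p * hubCount w i))| := by congr 1; ring
    _ ≤ |e * (hubCount w i - hubCount z i)| + (|e * hubCount z i - s|
          + |s - p * hubCount w i|) :=
        (abs_add_le _ _).trans (add_le_add_right (abs_add_le _ _) _)
    _ ≤ _ := by linarith

lemma sum_prod_bern_mul {ι : Type*} [Fintype ι] [DecidableEq ι] (a : ι → ℝ)
    (φ : ι → Bool → ℝ) :
    ∑ g : ι → Bool, (∏ j, bern (a j) (g j)) * ∏ j, φ j (g j)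
      = ∏ j, ∑ b, bern (a j) b * φ j b := by
  simp only [← Finset.prod_mul_distrib]
  rw [← Fintype.prod_sum (fun j b => bern (a j) b * φ j b)]

/-- The expectation of a function of the hub and of the membership of one node. -/
lemma sum_hubWeight_mul {nL n : ℕ} (θ : HubParams nL n) (j : Fin n) (ψ : Fin nL → Bool → ℝ) :
    ∑ y, hubWeight θ y * ψ y.1 (y.2 j) = ∑ i, θ.ρ i * ∑ b, bern (θ.A i j) b * ψ i b := by
  classical
  rw [Fintype.sum_prod_type]
  refine Finset.sum_congr rfl fun i _ => ?_
  have h := sum_prod_bern_mul (θ.A i) (fun j' b => if j' = j then ψ i b else 1)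
  have e : ∀ g : Fin n → Bool, (∏ j', if j' = j then ψ i (g j') else 1) = ψ i (g j) := by
    intro g; simp
  simp only [e] at h
  simp only [hubWeight, mul_assoc, ← Finset.mul_sum]
  rw [h, Finset.prod_eq_single j]
  · simp
  · intro j' _ hj'
    simp only [if_neg hj', mul_one, sum_bern]
  · simp

/-- Indicator of the event that a group is formed by hub `i` and contains no other hub. -/
def soleHub {nL n : ℕ} (h : nL ≤ n) (i : Fin nL) (y : Fin nL × (Fin n → Bool)) : ℝ :=
  if y.1 = i ∧ ∀ k, k ≠ i → y.2 (Fin.castLE h k) = false then 1 else 0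

lemma sum_hubWeight_mul_soleHub_ge {nL n : ℕ} (θ : HubParams nL n) (i : Fin nL) {x : ℝ}
    (hx0 : 0 ≤ x) (hx1 : x ≤ 1) (hA : ∀ k, k ≠ i → θ.A i (Fin.castLE θ.le k) ≤ x) :
    θ.ρ i * (1 - x) ^ nL ≤ ∑ y, hubWeight θ y * soleHub θ.le i y := by
  classical
  rw [Fintype.sum_prod_type]
  have hnn : ∀ k, 0 ≤ ∑ g : Fin n → Bool, hubWeight θ (k, g) * soleHub θ.le i (k, g) := fun k =>
    Finset.sum_nonneg fun g _ => mul_nonneg (hubWeight_nonneg θ _) (by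
      unfold soleHub; split_ifs <;> norm_num)
  refine le_trans ?_ (Finset.single_le_sum (fun k _ => hnn k) (Finset.mem_univ i))
  simp only [hubWeight, mul_assoc, ← Finset.mul_sum]
  refine mul_le_mul_of_nonneg_left ?_ (θ.ρ_nonneg i)
  have e : ∀ g : Fin n → Bool, soleHub θ.le i (i, g)
      = ∏ j, (if (∃ k, k ≠ i ∧ Fin.castLE θ.le k = j) ∧ g j = true then (0 : ℝ) else 1) := by
    intro g
    unfold soleHub
    split_ifs with h
    · refine (Finset.prod_eq_one fun j _ => if_neg ?_).symm
      rintro ⟨⟨k, hk, rfl⟩, hg⟩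
      exact Bool.false_ne_true ((h.2 k hk).symm.trans hg)
    · have : ∃ k, k ≠ i ∧ g (Fin.castLE θ.le k) = true := by
        simpa using h
      obtain ⟨k, hk, hg⟩ := this
      symm
      exact Finset.prod_eq_zero (Finset.mem_univ (Fin.castLE θ.le k))
        (if_pos ⟨⟨k, hk, rfl⟩, hg⟩)
  simp only [e]
  rw [sum_prod_bern_mul (θ.A i)
    (fun j b => if (∃ k, k ≠ i ∧ Fin.castLE θ.le k = j) ∧ b = true then (0 : ℝ) else 1)]
  have h1 : ∏ j : Fin n, (if ∃ k, k ≠ i ∧ Fin.castLE θ.le k = j then 1 - x else 1)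
      ≤ ∏ j, ∑ b, bern (θ.A i j) b *
        (if (∃ k, k ≠ i ∧ Fin.castLE θ.le k = j) ∧ b = true then (0 : ℝ) else 1) := by
    refine Finset.prod_le_prod (fun j _ => ?_) fun j _ => ?_
    · split_ifs <;> linarith
    · by_cases h : ∃ k, k ≠ i ∧ Fin.castLE θ.le k = j
      · obtain ⟨k, hk, hkj⟩ := id h
        have := hA k hk
        rw [hkj] at this
        rw [if_pos h, Fintype.sum_bool]
        simp only [h, true_and, bern, if_true, mul_zero, Bool.false_eq_true, if_false, mul_one,
          zero_add]
        linarith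
      · rw [if_neg h]
        simp only [h, false_and, if_false, mul_one, sum_bern, le_refl]
  refine le_trans ?_ h1
  rw [Finset.prod_ite, Finset.prod_const_one, mul_one, Finset.prod_const]
  refine pow_le_pow_of_le_one (by linarith) (by linarith) ?_
  calc (Finset.univ.filter fun j => ∃ k, k ≠ i ∧ Fin.castLE θ.le k = j).card
      ≤ (Finset.univ.image (Fin.castLE θ.le)).card := by
        refine Finset.card_le_card fun j hj => ?_
        obtain ⟨k, -, hk⟩ := (Finset.mem_filter.1 hj).2
        exact Finset.mem_image.2 ⟨k, Finset.mem_univ k, hk⟩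
    _ ≤ nL := Finset.card_image_le.trans (by simp)

lemma sum_hubWeight_mul_sq_le {nL n : ℕ} (θ : HubParams nL n) (i : Fin nL)
    {f : Fin nL × (Fin n → Bool) → ℝ} (hf : ∀ y, |f y| ≤ 1) (hfi : ∀ y, y.1 ≠ i → f y = 0) :
    ∑ y, hubWeight θ y * f y ^ 2 ≤ θ.ρ i := by
  classical
  have h := sum_hubWeight_mul θ (Fin.castLE θ.le i) (fun i' _ => if i' = i then (1 : ℝ) else 0)
  have e : ∑ i', θ.ρ i' * ∑ b, bern (θ.A i' (Fin.castLE θ.le i)) b * (if i' = i then (1 : ℝ) else 0)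
      = θ.ρ i := by
    simp only [← Finset.sum_mul, sum_bern, one_mul]
    simp
  rw [e] at h
  rw [← h]
  refine Finset.sum_le_sum fun y _ => mul_le_mul_of_nonneg_left ?_ (hubWeight_nonneg θ y)
  split_ifs with hy
  · exact (sq_le_one_iff_abs_le_one _).2 (hf y)
  · simp [hfi y hy]

/-- The centered membership of node `j` in the groups of hub `i`. -/
def hubDev {nL n : ℕ} (θ : HubParams nL n) (i : Fin nL) (j : Fin n)
    (y : Fin nL × (Fin n → Bool)) : ℝ :=
  if y.1 = i then (if y.2 j = true then (1 : ℝ) else 0) - θ.A i j else 0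

lemma abs_hubDev_le {nL n : ℕ} (θ : HubParams nL n) (i : Fin nL) (j : Fin n)
    (y : Fin nL × (Fin n → Bool)) : |hubDev θ i j y| ≤ 1 := by
  have h0 := θ.A_nonneg i j
  have h1 := θ.A_le_one i j
  unfold hubDev
  rw [abs_le]
  split_ifs <;> constructor <;> linarith

lemma sum_hubWeight_mul_hubDev {nL n : ℕ} (θ : HubParams nL n) (i : Fin nL) (j : Fin n) :
    ∑ y, hubWeight θ y * hubDev θ i j y = 0 := by
  refine (sum_hubWeight_mul θ j
    (fun i' b => if i' = i then (if b = true then (1 : ℝ) else 0) - θ.A i j else 0)).trans ?_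
  refine Finset.sum_eq_zero fun i' _ => ?_
  by_cases h : i' = i
  · subst h
    simp only [Fintype.sum_bool, bern, if_true, Bool.false_eq_true, if_false]
    ring
  · simp [h]

lemma IsHubSample.real_le_sum_hubDev_le {nL n T : ℕ} {θ : HubParams nL n} {Ω : Type*}
    [MeasurableSpace Ω] {μ : Measure Ω} [IsProbabilityMeasure μ] {z : Fin T → Ω → Fin nL}
    {G : Fin T → Ω → Fin n → Bool} (h : IsHubSample θ μ z G) (i : Fin nL) (j : Fin n)
    {c s η : ℝ} (hρ : θ.ρ i ≤ c / nL) (hs0 : 0 ≤ s) (hs1 : s ≤ 1) :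
    μ.real {ω | η * (T / nL) ≤ |∑ t, hubDev θ i j (z t ω, G t ω)|}
      ≤ 2 * Real.exp ((s ^ 2 * c - s * η) * (T / nL)) := by
  have hz : ∀ y : Fin nL × (Fin n → Bool), y.1 ≠ i → hubDev θ i j y = 0 := fun y hy => if_neg hy
  have h1 := h.real_le_sum_le (hubDev θ i j) (abs_hubDev_le θ i j) (a := η * (T / nL))
    (sum_hubWeight_mul_hubDev θ i j).le
    ((sum_hubWeight_mul_sq_le θ i (abs_hubDev_le θ i j) hz).trans hρ) hs0 hs1
  have h2 := h.real_le_sum_le (fun y => -hubDev θ i j y)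
    (fun y => by rw [abs_neg]; exact abs_hubDev_le θ i j y) (a := η * (T / nL)) (m := 0)
    (by simp [sum_hubWeight_mul_hubDev])
    ((sum_hubWeight_mul_sq_le θ i (fun y => by rw [abs_neg]; exact abs_hubDev_le θ i j y)
      fun y hy => by rw [hz y hy, neg_zero]).trans hρ) hs0 hs1
  have e : -s * (η * (T / nL)) + T * (s * 0 + s ^ 2 * (c / nL))
      = (s ^ 2 * c - s * η) * (T / nL) := by ring
  rw [e] at h1 h2
  have hsub : {ω | η * (T / nL) ≤ |∑ t, hubDev θ i j (z t ω, G t ω)|}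
      ⊆ {ω | η * (T / nL) ≤ ∑ t, hubDev θ i j (z t ω, G t ω)}
        ∪ {ω | η * (T / nL) ≤ ∑ t, -hubDev θ i j (z t ω, G t ω)} := by
    intro ω hω
    have hω' : η * (T / nL) ≤ |∑ t, hubDev θ i j (z t ω, G t ω)| := hω
    rcases le_abs.1 hω' with h | h
    · exact Or.inl h
    · refine Or.inr ?_
      rw [Set.mem_ofPred_eq, Finset.sum_neg_distrib]
      exact h
  have := (measureReal_mono hsub (μ := μ)).trans (measureReal_union_le _ _)
  linarith

lemma IsHubSample.real_sum_soleHub_le {nL n T : ℕ} {θ : HubParams nL n} {Ω : Type*}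
    [MeasurableSpace Ω] {μ : Measure Ω} [IsProbabilityMeasure μ] {z : Fin T → Ω → Fin nL}
    {G : Fin T → Ω → Fin n → Bool} (h : IsHubSample θ μ z G) (i : Fin nL)
    {c c₁ s : ℝ} (hρ : θ.ρ i ≤ c / nL)
    (hM : c₁ / nL ≤ ∑ y, hubWeight θ y * soleHub θ.le i y) (hs0 : 0 ≤ s) (hs1 : s ≤ 1) :
    μ.real {ω | ∑ t, soleHub θ.le i (z t ω, G t ω) ≤ c₁ / 2 * (T / nL)}
      ≤ Real.exp ((s ^ 2 * c - s * (c₁ / 2)) * (T / nL)) := by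
  have ha : ∀ y, |-soleHub θ.le i y| ≤ 1 := by
    intro y; unfold soleHub; split_ifs <;> simp
  have hz : ∀ y : Fin nL × (Fin n → Bool), y.1 ≠ i → -soleHub θ.le i y = 0 := by
    intro y hy; simp [soleHub, hy]
  have h1 := h.real_le_sum_le (fun y => -soleHub θ.le i y) ha (a := -(c₁ / 2 * (T / nL)))
    (m := -(c₁ / nL)) (by simpa using hM)
    ((sum_hubWeight_mul_sq_le θ i ha hz).trans hρ) hs0 hs1
  have e : -s * -(c₁ / 2 * (T / nL)) + T * (s * -(c₁ / nL) + s ^ 2 * (c / nL))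
      = (s ^ 2 * c - s * (c₁ / 2)) * (T / nL) := by ring
  rw [e] at h1
  refine le_trans (measureReal_mono fun ω hω => ?_) h1
  rw [Set.mem_ofPred_eq, Finset.sum_neg_distrib]
  exact neg_le_neg hω

lemma IsHubSample.real_le_sum_member_le {nL n T : ℕ} {θ : HubParams nL n} {Ω : Type*}
    [MeasurableSpace Ω] {μ : Measure Ω} [IsProbabilityMeasure μ] {z : Fin T → Ω → Fin nL}
    {G : Fin T → Ω → Fin n → Bool} (h : IsHubSample θ μ z G) (j : Fin n) {C : ℝ}
    (hU : ∑ i, θ.ρ i * θ.A i j ≤ C / nL) :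
    μ.real {ω | 3 * C * (T / nL) ≤ ∑ t, if G t ω j = true then (1 : ℝ) else 0}
      ≤ Real.exp (-C * (T / nL)) := by
  have e0 : ∑ y, hubWeight θ y * (if y.2 j = true then (1 : ℝ) else 0) = ∑ i, θ.ρ i * θ.A i j := by
    refine (sum_hubWeight_mul θ j (fun _ b => if b = true then (1 : ℝ) else 0)).trans ?_
    simp [bern]
  have h1 := h.real_le_sum_le (fun y => if y.2 j = true then (1 : ℝ) else 0)
    (fun y => by split_ifs <;> simp) (a := 3 * C * (T / nL)) (e0.le.trans hU)
    (σ := C / nL) (by simpa [ite_pow] using e0.le.trans hU) zero_le_one le_rfl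
  have e : -1 * (3 * C * (T / nL)) + T * (1 * (C / nL) + 1 ^ 2 * (C / nL))
      = -C * (T / nL) := by ring
  rwa [e] at h1

lemma measureReal_iUnion_le_card_mul {ι Ω : Type*} [Fintype ι] [MeasurableSpace Ω]
    (μ : Measure Ω) (S : ι → Set Ω) {b : ℝ} (hb : ∀ i, μ.real (S i) ≤ b) :
    μ.real (⋃ i, S i) ≤ Fintype.card ι * b := by
  refine (measureReal_iUnion_fintype_le _).trans ((Finset.sum_le_sum fun i _ => hb i).trans ?_)
  simp

/-- Almost surely the true labels are feasible and have positive likelihood. -/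
lemma IsHubSample.ae_feasible {nL n T : ℕ} {θ : HubParams nL n} {Ω : Type*}
    [MeasurableSpace Ω] {μ : Measure Ω} [IsProbabilityMeasure μ] {z : Fin T → Ω → Fin nL}
    {G : Fin T → Ω → Fin n → Bool} (h : IsHubSample θ μ z G) :
    ∀ᵐ ω ∂μ, Feasible θ.le (fun t => G t ω) (fun t => z t ω) ∧
      lik (fun t => G t ω) θ.A (fun t => z t ω) ≠ 0 := by
  have h0 := h.real_mem_eq {x | ∏ t, hubWeight θ (x t) = 0}
  have h1 : ∑ x, Set.indicator {x : Fin T → Fin nL × (Fin n → Bool) |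
      ∏ t, hubWeight θ (x t) = 0} (fun x => ∏ t, hubWeight θ (x t)) x = 0 := by
    refine Finset.sum_eq_zero fun x _ => ?_
    by_cases hx : ∏ t, hubWeight θ (x t) = 0
    · exact Set.indicator_apply_eq_zero.2 fun _ => hx
    · exact Set.indicator_of_notMem (by exact hx) _
  rw [h1, measureReal_eq_zero_iff] at h0
  have h2 : ∀ᵐ ω ∂μ, ¬ (∏ t, hubWeight θ (z t ω, G t ω) = 0) := by
    rw [ae_iff]; simpa using h0
  filter_upwards [h2] with ω hω
  have hne : ∀ t j, bern (θ.A (z t ω) j) (G t ω j) ≠ 0 := fun t j =>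
    Finset.prod_ne_zero_iff.1 (right_ne_zero_of_mul
      (Finset.prod_ne_zero_iff.1 hω t (Finset.mem_univ t))) j (Finset.mem_univ j)
  refine ⟨fun t => ?_, Finset.prod_ne_zero_iff.2 fun t _ => Finset.prod_ne_zero_iff.2
    fun j _ => hne t j⟩
  by_contra hf
  have := hne t (Fin.castLE θ.le (z t ω))
  rw [θ.A_self] at this
  simp [bern, hf] at this

lemma sum_soleHub_le_card {nL n T : ℕ} {h : nL ≤ n} {g : Fin T → Fin n → Bool}
    (w : Fin T → Fin nL) {z : Fin T → Fin nL} (hz : Feasible h g z) (k : Fin nL) :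
    ∑ t, soleHub h k (w t, g t) ≤ (Finset.univ.filter fun t => w t = k ∧ z t = k).card := by
  classical
  unfold soleHub
  rw [Finset.sum_boole]
  refine Nat.cast_le.2 (Finset.card_le_card fun t ht => ?_)
  obtain ⟨h1, h2⟩ := (Finset.mem_filter.1 ht).2
  refine Finset.mem_filter.2 ⟨Finset.mem_univ t, h1, ?_⟩
  by_contra h3
  exact Bool.false_ne_true ((h2 _ h3).symm.trans (hz t))

lemma hubCount_le_sum_member {nL n T : ℕ} {h : nL ≤ n} {g : Fin T → Fin n → Bool}
    {z : Fin T → Fin nL} (hz : Feasible h g z) (k : Fin nL) :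
    (hubCount z k : ℝ) ≤ ∑ t, if g t (Fin.castLE h k) = true then (1 : ℝ) else 0 := by
  rw [Finset.sum_boole]
  refine Nat.cast_le.2 (Finset.card_le_card fun t ht => ?_)
  have h1 := (Finset.mem_filter.1 ht).2
  exact Finset.mem_filter.2 ⟨Finset.mem_univ t, h1 ▸ hz t⟩

/-- A bound on the maximal error when the sample is typical. -/
lemma maxError_lt_of_typical {nL n T : ℕ} {θ : HubParams nL n} {g : Fin T → Fin n → Bool}
    {w z : Fin T → Fin nL} {c₁ ε r : ℝ} (hc₁ : 0 < c₁) (hε : 0 < ε) (hr : 0 < r)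
    (hcount : ∀ i, c₁ / 2 * r ≤ hubCount w i) (herr : labelErr w z ≤ c₁ * ε / 16 * r)
    (hdev : ∀ i j, |∑ t, hubDev θ i j (w t, g t)| ≤ c₁ * ε / 8 * r) :
    maxError θ g z < ε := by
  refine lt_of_le_of_lt (Real.iSup_le (fun p => ?_) (half_pos hε).le) (half_lt_self hε)
  have hpos : (0 : ℝ) < hubCount w p.1 := lt_of_lt_of_le (by positivity) (hcount p.1)
  refine (abs_estA_sub_le g w z p.1 p.2 (θ.A p.1 p.2) (by exact_mod_cast hpos)).trans ?_
  rw [div_le_iff₀ hpos]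
  have h1 := hdev p.1 p.2
  have h2 := mul_le_mul_of_nonneg_left (hcount p.1) (half_pos hε).le
  unfold hubDev at h1
  nlinarith

/-- The tail bound for the maximal error, with a rate which does not depend on the model. -/
lemma exists_rate.{u} {c₁ C c₂ ε : ℝ} (hc₁ : 0 < c₁) (hC : 0 < C) (hc₂ : 0 < c₂) (hε : 0 < ε) :
    ∃ κ : ℝ, 0 < κ ∧ ∀ {nL n T : ℕ} (θ : HubParams nL n) {Ω : Type u} [MeasurableSpace Ω]
      (μ : Measure Ω) [IsProbabilityMeasure μ] (z : Fin T → Ω → Fin nL)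
      (G : Fin T → Ω → Fin n → Bool) (zhat : Ω → Fin T → Fin nL) (d v : ℝ),
      IsHubSample θ μ z G → (∀ᵐ ω ∂μ, IsProfileMLE θ.le (fun t => G t ω) (zhat ω)) →
      0 < T → 0 < nL → (∀ i, θ.ρ i ≤ c₂ / nL) →
      (∀ i, c₁ / nL ≤ ∑ y, hubWeight θ y * soleHub θ.le i y) →
      (∀ k, ∑ i, θ.ρ i * θ.A i (Fin.castLE θ.le k) ≤ C / nL) →
      0 < d → 0 < v → HubsSeparated θ d v →
      μ.real {ω | ε ≤ maxError θ (fun t => G t ω) (zhat ω)}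
        ≤ 4 * (n : ℝ) ^ 2 * Real.exp (-κ * (T / nL))
          + (nL : ℝ) ^ T * ((T : ℝ) + 1) ^ (n * nL)
            * Real.exp (-κ * (d ^ 2 * v * n * T / nL ^ 2)) := by
  obtain ⟨s, hs0, hs1, hsA, hsB⟩ : ∃ s : ℝ, 0 < s ∧ s ≤ 1 ∧ s * c₂ ≤ c₁ / 4 ∧
      s * c₂ ≤ c₁ * ε / 16 := by
    refine ⟨min 1 (min (c₁ / 4 / c₂) (c₁ * ε / 16 / c₂)), by positivity, min_le_left _ _, ?_, ?_⟩
    · rw [← le_div_iff₀ hc₂]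
      exact (min_le_right _ _).trans (min_le_left _ _)
    · rw [← le_div_iff₀ hc₂]
      exact (min_le_right _ _).trans (min_le_right _ _)
  refine ⟨min (min (s * (c₁ / 4)) (s * (c₁ * ε / 16))) (min C (c₁ / (6 * C) * (c₁ * ε / 16) / 4)),
    by positivity, ?_⟩
  generalize hκ : min (min (s * (c₁ / 4)) (s * (c₁ * ε / 16)))
    (min C (c₁ / (6 * C) * (c₁ * ε / 16) / 4)) = κ
  have hκ1 : κ ≤ s * (c₁ / 4) := hκ ▸ (min_le_left _ _).trans (min_le_left _ _)
  have hκ2 : κ ≤ s * (c₁ * ε / 16) := hκ ▸ (min_le_left _ _).trans (min_le_right _ _)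
  have hκ3 : κ ≤ C := hκ ▸ (min_le_right _ _).trans (min_le_left _ _)
  have hκ4 : κ ≤ c₁ / (6 * C) * (c₁ * ε / 16) / 4 :=
    hκ ▸ (min_le_right _ _).trans (min_le_right _ _)
  intro nL n T θ Ω _ μ _ z G zhat d v hsample hzhat hT hnL hρ hM hU hd hv hsep
  have hr : (0 : ℝ) < T / nL := by positivity
  have hnLn : (nL : ℝ) ≤ n := by exact_mod_cast θ.le
  have hn1 : (1 : ℝ) ≤ n := by exact_mod_cast hnL.trans_le θ.le
  let R : (Fin T → Fin nL) → (Fin T → Fin nL) → Prop := fun w z' =>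
    (∀ k, c₁ / (6 * C) * hubCount z' k ≤ (Finset.univ.filter fun t => w t = k ∧ z' t = k).card) ∧
      c₁ * ε / 16 * (T / nL) ≤ labelErr w z'
  let S₁ : Fin nL → Set Ω := fun i =>
    {ω | ∑ t, soleHub θ.le i (z t ω, G t ω) ≤ c₁ / 2 * (T / nL)}
  let S₂ : Fin nL → Set Ω := fun k =>
    {ω | 3 * C * (T / nL) ≤ ∑ t, if G t ω (Fin.castLE θ.le k) = true then (1 : ℝ) else 0}
  let S₃ : Fin nL × Fin n → Set Ω := fun p =>
    {ω | c₁ * ε / 8 * (T / nL) ≤ |∑ t, hubDev θ p.1 p.2 (z t ω, G t ω)|}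
  let S₄ : Set Ω := {ω | ∃ z', R (fun t => z t ω) z' ∧ lik (fun t => G t ω) θ.A (fun t => z t ω)
    ≤ lik (fun t => G t ω) (estA (fun t => G t ω) z') z'}
  let N : Set Ω := {ω | ¬ (IsProfileMLE θ.le (fun t => G t ω) (zhat ω) ∧
    Feasible θ.le (fun t => G t ω) (fun t => z t ω) ∧
      lik (fun t => G t ω) θ.A (fun t => z t ω) ≠ 0)}
  have hN : μ.real N = 0 := by
    rw [measureReal_eq_zero_iff]
    exact ae_iff.1 (hzhat.and hsample.ae_feasible)
  have h₁ : μ.real (⋃ i, S₁ i) ≤ nL * Real.exp (-κ * (T / nL)) := by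
    have := measureReal_iUnion_le_card_mul μ S₁ (b := Real.exp (-κ * (T / nL))) fun i =>
      (hsample.real_sum_soleHub_le i (hρ i) (hM i) hs0.le hs1).trans
        (Real.exp_le_exp.2 (mul_le_mul_of_nonneg_right (by nlinarith) hr.le))
    simpa using this
  have h₂ : μ.real (⋃ i, S₂ i) ≤ nL * Real.exp (-κ * (T / nL)) := by
    have := measureReal_iUnion_le_card_mul μ S₂ (b := Real.exp (-κ * (T / nL))) fun k =>
      (hsample.real_le_sum_member_le _ (hU k)).trans
        (Real.exp_le_exp.2 (mul_le_mul_of_nonneg_right (by linarith) hr.le))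
    simpa using this
  have h₃ : μ.real (⋃ p, S₃ p) ≤ nL * n * (2 * Real.exp (-κ * (T / nL))) := by
    have := measureReal_iUnion_le_card_mul μ S₃ (b := 2 * Real.exp (-κ * (T / nL))) fun p =>
      (hsample.real_le_sum_hubDev_le p.1 p.2 (hρ p.1) hs0.le hs1).trans
        (mul_le_mul_of_nonneg_left
          (Real.exp_le_exp.2 (mul_le_mul_of_nonneg_right (by nlinarith) hr.le)) zero_le_two)
    simpa using this
  have h₄ : μ.real S₄ ≤ (nL : ℝ) ^ T * ((T : ℝ) + 1) ^ (n * nL)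
      * Real.exp (-κ * (d ^ 2 * v * n * T / nL ^ 2)) := by
    refine (hsample.real_exists_lik_le R (E := c₁ / (6 * C) * d ^ 2 * (v * n / nL)
      * (c₁ * ε / 16 * (T / nL))) fun w z' B hR => ?_).trans ?_
    · exact (mul_le_mul_of_nonneg_left hR.2 (by positivity)).trans
        (sum_sum_sq_sub_ge hd hsep hR.1 (by positivity) B)
    · refine mul_le_mul_of_nonneg_left (Real.exp_le_exp.2 ?_) (by positivity)
      have := mul_le_mul_of_nonneg_right hκ4
        (show 0 ≤ d ^ 2 * v * n * T / (nL : ℝ) ^ 2 by positivity)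
      have e : -(c₁ / (6 * C) * d ^ 2 * (v * n / nL) * (c₁ * ε / 16 * (T / nL))) / 4
          = -(c₁ / (6 * C) * (c₁ * ε / 16) / 4 * (d ^ 2 * v * n * T / (nL : ℝ) ^ 2)) := by
        field_simp
      rw [e]
      linarith
  have hsub : {ω | ε ≤ maxError θ (fun t => G t ω) (zhat ω)}
      ⊆ N ∪ ((⋃ i, S₁ i) ∪ ((⋃ i, S₂ i) ∪ ((⋃ p, S₃ p) ∪ S₄))) := by
    intro ω hω
    by_contra hbad
    simp only [Set.mem_union, Set.mem_iUnion, not_or, not_exists] at hbad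
    obtain ⟨hb0, hb1, hb2, hb3, hb4⟩ := hbad
    obtain ⟨hmle, hfeas, hlik⟩ := not_not.1 hb0
    have hsole : ∀ k, c₁ / 2 * (T / nL) ≤ ∑ t, soleHub θ.le k (z t ω, G t ω) := fun k =>
      (not_le.1 (hb1 k)).le
    refine absurd (show ε ≤ maxError θ (fun t => G t ω) (zhat ω) from hω) (not_le.2
      (maxError_lt_of_typical (w := fun t => z t ω) hc₁ hε hr (fun i => ?_) ?_ fun i j =>
        (not_le.1 (hb3 (i, j))).le))
    · refine ((hsole i).trans (sum_soleHub_le_card (fun t => z t ω) hfeas i)).trans ?_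
      exact_mod_cast Finset.card_le_card fun t ht => by simpa using ht
    · by_contra herr
      refine hb4 ⟨zhat ω, ⟨fun k => ?_, (not_le.1 herr).le⟩,
        hmle.lik_le θ.A_nonneg θ.A_le_one hfeas hlik⟩
      refine le_trans ?_ ((hsole k).trans (sum_soleHub_le_card (fun t => z t ω) hmle.1 k))
      have h5 := (hubCount_le_sum_member hmle.1 k).trans (not_le.1 (hb2 k)).le
      refine (mul_le_mul_of_nonneg_left h5 (by positivity)).trans (le_of_eq ?_)
      field_simp
      ring
  have hexp := (Real.exp_pos (-κ * (T / nL))).le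
  have htot : μ.real {ω | ε ≤ maxError θ (fun t => G t ω) (zhat ω)}
      ≤ μ.real N + (μ.real (⋃ i, S₁ i) + (μ.real (⋃ i, S₂ i) + (μ.real (⋃ p, S₃ p) + μ.real S₄))) := by
    refine (measureReal_mono hsub).trans ((measureReal_union_le _ _).trans ?_)
    gcongr
    refine (measureReal_union_le _ _).trans ?_
    gcongr
    refine (measureReal_union_le _ _).trans ?_
    gcongr
    exact measureReal_union_le _ _
  have hcoef : (nL : ℝ) + nL + nL * n * 2 ≤ 4 * (n : ℝ) ^ 2 := by nlinarith
  have := mul_le_mul_of_nonneg_right hcoef hexp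
  linarith

lemma HubParams.pos {nL n : ℕ} (θ : HubParams nL n) : 0 < nL := by
  rcases Nat.eq_zero_or_pos nL with rfl | h
  · have := θ.ρ_sum
    simp at this
  · exact h

lemma HubsSeparated.sq_mul_le {nL n : ℕ} {θ : HubParams nL n} {d v : ℝ}
    (h : HubsSeparated θ d v) (hd : 0 < d) (hv : 0 < v) (hnL : 2 ≤ nL) : d ^ 2 * v ≤ nL := by
  obtain ⟨V, hV⟩ := h
  have hnL0 : (0 : ℝ) < nL := by exact_mod_cast θ.pos
  have hn0 : (0 : ℝ) < n := by exact_mod_cast θ.pos.trans_le θ.le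
  let i : Fin nL := ⟨0, by lia⟩
  let i' : Fin nL := ⟨1, by lia⟩
  have hcard : ((V i).card : ℝ) ≤ n := by
    exact_mod_cast (Finset.card_le_univ (V i)).trans (Fintype.card_fin n).le
  have hv' : v ≤ nL := by
    have h1 := (hV i).1.trans hcard
    rw [div_le_iff₀ hnL0] at h1
    nlinarith
  have hpos : (0 : ℝ) < (V i).card := lt_of_lt_of_le (by positivity) (hV i).1
  obtain ⟨j, hj⟩ := Finset.card_pos.1 (by exact_mod_cast hpos : 0 < (V i).card)
  have hd1 : d ≤ 1 := by
    have h1 := (hV i).2 j hj i' (by simp [i, i'])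
    have h2 := θ.A_le_one i j
    have h3 := θ.A_nonneg i' j
    linarith
  have : d ^ 2 ≤ 1 := pow_le_one₀ hd.le hd1
  nlinarith

lemma four_mul_sq_mul_exp_le {n κ r : ℝ} (hn : 0 < n) (h : 3 * Real.log n ≤ κ * r) :
    4 * n ^ 2 * Real.exp (-κ * r) ≤ 4 / n := by
  have h1 : Real.exp (-κ * r) ≤ (n ^ 3)⁻¹ := by
    rw [← Real.exp_log (show 0 < (n ^ 3)⁻¹ by positivity), Real.log_inv, Real.log_pow]
    refine Real.exp_le_exp.2 ?_
    push_cast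
    linarith
  refine (mul_le_mul_of_nonneg_left h1 (by positivity)).trans (le_of_eq ?_)
  field_simp

lemma pow_mul_pow_mul_exp_le {nL n T : ℕ} (hnL : 0 < nL) (hn : 0 < n) {a : ℝ}
    (h1 : 4 * (T * Real.log nL) ≤ a) (h2 : 4 * (n * nL * Real.log (T + 1)) ≤ a) :
    (nL : ℝ) ^ T * ((T : ℝ) + 1) ^ (n * nL) * Real.exp (-a) ≤ 1 / ((T : ℝ) + 1) := by
  have hT : (0 : ℝ) < (T : ℝ) + 1 := by positivity
  have hlog : 0 ≤ Real.log ((T : ℝ) + 1) := Real.log_nonneg (by linarith [Nat.cast_nonneg (α := ℝ) T])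
  have hnn : (1 : ℝ) ≤ n * nL := by exact_mod_cast Nat.mul_pos hn hnL
  have h3 : Real.log (T + 1) ≤ n * nL * Real.log (T + 1) := le_mul_of_one_le_left hlog hnn
  rw [← Real.exp_log (show (0 : ℝ) < (nL : ℝ) ^ T by positivity),
    ← Real.exp_log (show (0 : ℝ) < ((T : ℝ) + 1) ^ (n * nL) by positivity),
    ← Real.exp_log (show (0 : ℝ) < 1 / ((T : ℝ) + 1) by positivity),
    ← Real.exp_add, ← Real.exp_add, Real.log_pow, Real.log_pow, one_div, Real.log_inv]
  refine Real.exp_le_exp.2 ?_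
  push_cast
  linarith

lemma eventually_mul_le_of_tendsto_div {f g : ℕ → ℝ} (hg : ∀ᶠ m in atTop, 0 < g m)
    (h : Tendsto (fun m => f m / g m) atTop (𝓝 0)) {M : ℝ} (hM : 0 < M) :
    ∀ᶠ m in atTop, M * f m ≤ g m := by
  filter_upwards [hg, h.eventually_lt_const (inv_pos.2 hM)] with m hm hlt
  rw [div_lt_iff₀ hm] at hlt
  have := mul_le_mul_of_nonneg_left hlt.le hM.le
  rwa [mul_inv_cancel_left₀ hM.ne'] at this

/-- Consistency of the estimator under uniform control of the hub frequencies. -/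
lemma tendsto_measure_le_maxError (nL n T : ℕ → ℕ) (θ : ∀ m, HubParams (nL m) (n m))
    {Ω : ℕ → Type*} [∀ m, MeasurableSpace (Ω m)]
    (μ : ∀ m, Measure (Ω m)) [∀ m, IsProbabilityMeasure (μ m)]
    (z : ∀ m, Fin (T m) → Ω m → Fin (nL m))
    (G : ∀ m, Fin (T m) → Ω m → Fin (n m) → Bool)
    (hsample : ∀ m, IsHubSample (θ m) (μ m) (z m) (G m))
    (zhat : ∀ m, Ω m → Fin (T m) → Fin (nL m))
    (hzhat : ∀ m, ∀ᵐ ω ∂(μ m), IsProfileMLE (θ m).le (fun t => G m t ω) (zhat m ω))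
    {c₁ C c₂ : ℝ} (hc₁ : 0 < c₁) (hC : 0 < C) (hc₂ : 0 < c₂)
    (hρ : ∀ m i, (θ m).ρ i ≤ c₂ / nL m)
    (hM : ∀ᶠ m in atTop, ∀ i,
      c₁ / nL m ≤ ∑ y, hubWeight (θ m) y * soleHub (θ m).le i y)
    (hU : ∀ m k, ∑ i, (θ m).ρ i * (θ m).A i (Fin.castLE (θ m).le k) ≤ C / nL m)
    (d v : ℕ → ℝ) (hd : ∀ m, 0 < d m) (hv : ∀ m, 0 < v m)
    (hsep : ∀ m, HubsSeparated (θ m) (d m) (v m))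
    (hn : Tendsto n atTop atTop) (hT : Tendsto T atTop atTop)
    (h1 : Tendsto (fun m => (nL m : ℝ) * Real.log (n m) / (T m : ℝ)) atTop (𝓝 0))
    (h2 : Tendsto (fun m => (nL m : ℝ) ^ 3 * Real.log (T m) / (d m ^ 2 * v m * (T m : ℝ)))
        atTop (𝓝 0))
    (h3 : ∀ M : ℝ, 0 < M → ∀ᶠ m in atTop,
      M * ((nL m : ℝ) ^ 2 * Real.log (nL m)) ≤ d m ^ 2 * v m * n m)
    {ε : ℝ} (hε : 0 < ε) :
    Tendsto (fun m => μ m {ω | ε ≤ maxError (θ m) (fun t => G m t ω) (zhat m ω)})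
      atTop (𝓝 0) := by
  obtain ⟨κ, hκ, hrate⟩ := exists_rate hc₁ hC hc₂ hε
  have hlim : Tendsto (fun m => ENNReal.ofReal (4 / (n m : ℝ) + 1 / ((T m : ℝ) + 1)))
      atTop (𝓝 0) := by
    have e1 : Tendsto (fun m => 4 / (n m : ℝ)) atTop (𝓝 0) :=
      tendsto_const_nhds.div_atTop (tendsto_natCast_atTop_atTop.comp hn)
    have e2 : Tendsto (fun m => 1 / ((T m : ℝ) + 1)) atTop (𝓝 0) :=
      tendsto_one_div_add_atTop_nhds_zero_nat.comp hT
    simpa using ENNReal.tendsto_ofReal (e1.add e2)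
  refine tendsto_of_tendsto_of_tendsto_of_le_of_le' tendsto_const_nhds hlim
    (Eventually.of_forall fun _ => zero_le) ?_
  have hTpos : ∀ᶠ m in atTop, 2 ≤ T m := hT.eventually_ge_atTop 2
  filter_upwards [hM, hTpos,
    eventually_mul_le_of_tendsto_div
      (hTpos.mono fun m hm => by positivity) h1 (show 0 < 3 / κ by positivity),
    eventually_mul_le_of_tendsto_div (hTpos.mono fun m hm => by
      have := hd m; have := hv m; positivity) h2 (show 0 < 8 / κ by positivity),
    h3 (4 / κ) (by positivity)] with m hMm hTm e1 e2 e3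
  have hnL := (θ m).pos
  have hn0 : 0 < n m := hnL.trans_le (θ m).le
  have hnL' : (0 : ℝ) < nL m := by exact_mod_cast hnL
  have hn0' : (0 : ℝ) < n m := by exact_mod_cast hn0
  have hT2 : (2 : ℝ) ≤ T m := by exact_mod_cast hTm
  have hT0 : (0 : ℝ) < T m := by linarith
  have hdv : 0 < d m ^ 2 * v m := mul_pos (pow_pos (hd m) 2) (hv m)
  rw [← ENNReal.ofReal_toReal (measure_ne_top (μ m) _)]
  refine ENNReal.ofReal_le_ofReal ((hrate (θ m) (μ m) (z m) (G m) (zhat m) (d m) (v m) (hsample m)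
    (hzhat m) (by lia) hnL (hρ m) hMm (hU m) (hd m) (hv m) (hsep m)).trans (add_le_add ?_ ?_))
  · refine four_mul_sq_mul_exp_le hn0' ?_
    rw [div_mul_eq_mul_div, div_le_iff₀ hκ] at e1
    rw [mul_div_assoc', le_div_iff₀ hnL']
    linarith
  · rw [neg_mul]
    refine pow_mul_pow_mul_exp_le hnL hn0 ?_ ?_
    · rw [div_mul_eq_mul_div, div_le_iff₀ hκ] at e3
      rw [mul_div_assoc', le_div_iff₀ (by positivity)]
      have := mul_le_mul_of_nonneg_right e3 hT0.le
      linarith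
    · have hlog : Real.log ((T m : ℝ) + 1) ≤ 2 * Real.log (T m) := by
        rw [← Nat.cast_two, ← Real.log_pow]
        exact Real.log_le_log (by positivity) (by nlinarith)
      rw [div_mul_eq_mul_div, div_le_iff₀ hκ] at e2
      rw [mul_div_assoc', le_div_iff₀ (by positivity)]
      have i1 := mul_le_mul_of_nonneg_right e2 hn0'.le
      have i2 := mul_le_mul_of_nonneg_left hlog
        (show 0 ≤ 4 * (n m * nL m ^ 3 : ℝ) by positivity)
      linarith

lemma exp_neg_le_one_sub_pow {c : ℝ} {k : ℕ} (hk : 0 < k) (hc : 0 ≤ c) (h : 2 * c ≤ k) :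
    Real.exp (-(2 * c)) ≤ (1 - c / k) ^ k := by
  have hk' : (0 : ℝ) < k := by exact_mod_cast hk
  have hx : c / k ≤ 1 / 2 := by rw [div_le_iff₀ hk']; linarith
  have hx0 : 0 ≤ c / k := by positivity
  have e : Real.exp (-(2 * c)) = Real.exp (-(2 * (c / k))) ^ k := by
    rw [← Real.exp_nat_mul]; congr 1; field_simp
  rw [e]
  refine pow_le_pow_left₀ (Real.exp_pos _).le ?_ k
  rw [Real.exp_neg, inv_le_comm₀ (Real.exp_pos _) (by linarith)]
  refine le_trans ?_ (Real.add_one_le_exp _)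
  rw [inv_le_iff_one_le_mul₀ (by linarith)]
  nlinarith

theorem theorem5 (nL n T : ℕ → ℕ) (θ : ∀ m, HubParams (nL m) (n m))
    {Ω : ℕ → Type*} [∀ m, MeasurableSpace (Ω m)]
    (μ : ∀ m, Measure (Ω m)) [∀ m, IsProbabilityMeasure (μ m)]
    (z : ∀ m, Fin (T m) → Ω m → Fin (nL m))
    (G : ∀ m, Fin (T m) → Ω m → Fin (n m) → Bool)
    (hsample : ∀ m, IsHubSample (θ m) (μ m) (z m) (G m))
    -- the estimated labels, with ties broken in any way
    (zhat : ∀ m, Ω m → Fin (T m) → Fin (nL m))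
    (hzhat : ∀ m, ∀ᵐ ω ∂(μ m), IsProfileMLE (θ m).le (fun t => G m t ω) (zhat m ω))
    (cmin cmax : ℝ) (hcmin : 0 < cmin)
    (hρ : ∀ m i, cmin / (nL m : ℝ) ≤ (θ m).ρ i ∧ (θ m).ρ i ≤ cmax / (nL m : ℝ))
    (d v : ℕ → ℝ) (hd : ∀ m, 0 < d m) (hv : ∀ m, 0 < v m)
    (hsep : ∀ m, HubsSeparated (θ m) (d m) (v m))
    (hn : Tendsto n atTop atTop) (hT : Tendsto T atTop atTop) :
    -- growing number of hubs
    (Tendsto nL atTop atTop →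
      (∃ c₀ : ℝ, 0 < c₀ ∧ ∀ m (i i' : Fin (nL m)), i ≠ i' →
        (θ m).A i (Fin.castLE (θ m).le i') ≤ c₀ / (nL m : ℝ)) →
      Tendsto (fun m => (nL m : ℝ) ^ 2 * Real.log (nL m) / (T m : ℝ)) atTop (𝓝 0) →
      Tendsto (fun m => (nL m : ℝ) ^ 3 * Real.log (T m) / (d m ^ 2 * v m * (T m : ℝ)))
        atTop (𝓝 0) →
      Tendsto (fun m => (nL m : ℝ) ^ 4 * Real.log (nL m) / (d m ^ 4 * v m ^ 2 * (n m : ℝ)))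
        atTop (𝓝 0) →
      Tendsto (fun m => (nL m : ℝ) * Real.log (n m) / (T m : ℝ)) atTop (𝓝 0) →
      ∀ ε : ℝ, 0 < ε →
        Tendsto (fun m => μ m {ω | ε ≤ maxError (θ m) (fun t => G m t ω) (zhat m ω)})
          atTop (𝓝 0)) ∧
    -- fixed number of hubs
    ((∃ K : ℕ, ∀ m, nL m = K) →
      (∃ c : ℝ, c < 1 ∧ ∀ m (i i' : Fin (nL m)), i ≠ i' →
        (θ m).A i (Fin.castLE (θ m).le i') ≤ c) →
      Tendsto (fun m => Real.log (T m) / (d m ^ 2 * v m * (T m : ℝ))) atTop (𝓝 0) →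
      Tendsto (fun m => d m ^ 4 * v m ^ 2 * (n m : ℝ)) atTop atTop →
      Tendsto (fun m => Real.log (n m) / (T m : ℝ)) atTop (𝓝 0) →
      ∀ ε : ℝ, 0 < ε →
        Tendsto (fun m => μ m {ω | ε ≤ maxError (θ m) (fun t => G m t ω) (zhat m ω)})
          atTop (𝓝 0)) := by
  have hnL : ∀ m, (0 : ℝ) < nL m := fun m => by exact_mod_cast (θ m).pos
  have hn0 : ∀ m, (0 : ℝ) < n m := fun m => by exact_mod_cast (θ m).pos.trans_le (θ m).le
  have hcmax : 0 < cmax := by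
    have h := (hρ 0 ⟨0, (θ 0).pos⟩).1.trans (hρ 0 ⟨0, (θ 0).pos⟩).2
    exact hcmin.trans_le ((div_le_div_iff_of_pos_right (hnL 0)).1 h)
  have hscale : ∀ m (M : ℝ), 0 < M → M * ((nL m : ℝ) ^ 4 * Real.log (nL m))
      ≤ d m ^ 4 * v m ^ 2 * n m → M * ((nL m : ℝ) ^ 2 * Real.log (nL m)) ≤ d m ^ 2 * v m * n m := by
    intro m M hM h
    have hu : 0 < d m ^ 2 * v m := mul_pos (pow_pos (hd m) 2) (hv m)
    rcases Nat.lt_or_ge (nL m) 2 with h2 | h2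
    · have h1 : nL m = 1 := by have := (θ m).pos; lia
      have := hn0 m
      simp only [h1, Nat.cast_one, Real.log_one, mul_zero]
      positivity
    · have h1 : (1 : ℝ) ≤ nL m := by exact_mod_cast (θ m).pos
      have h3 : d m ^ 2 * v m ≤ (nL m : ℝ) ^ 2 :=
        ((hsep m).sq_mul_le (hd m) (hv m) h2).trans (by nlinarith)
      have h4 := mul_le_mul_of_nonneg_left h3
        (show 0 ≤ M * ((nL m : ℝ) ^ 2 * Real.log (nL m)) by
          have := Real.log_nonneg h1; positivity)
      refine le_of_mul_le_mul_left ?_ hu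
      linarith
  refine ⟨?_, ?_⟩
  · rintro hgrow ⟨c₀, hc₀, hA⟩ - h2 h3 h1 ε hε
    refine tendsto_measure_le_maxError nL n T θ μ z G hsample zhat hzhat
      (c₁ := cmin * Real.exp (-(2 * c₀))) (C := cmax + c₀) (by positivity) (by positivity) hcmax
      (fun m i => (hρ m i).2) ?_ (fun m k => ?_) d v hd hv hsep hn hT h1 h2 (fun M hM => ?_) hε
    · filter_upwards [(tendsto_natCast_atTop_atTop.comp hgrow).eventually_ge_atTop (2 * c₀)]
        with m hm i
      have hm' : 2 * c₀ ≤ nL m := hm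
      refine le_trans ?_ (sum_hubWeight_mul_soleHub_ge (θ m) i (x := c₀ / nL m)
        (div_pos hc₀ (hnL m)).le ((div_le_one (hnL m)).2 (by linarith))
        fun k hk => hA m i k hk.symm)
      rw [mul_div_right_comm]
      exact mul_le_mul (hρ m i).1 (exp_neg_le_one_sub_pow (θ m).pos hc₀.le hm')
        (Real.exp_pos _).le ((θ m).ρ_nonneg i)
    · have hterm : ∀ i, (θ m).ρ i * (θ m).A i (Fin.castLE (θ m).le k)
          ≤ (if i = k then cmax / nL m else 0) + (θ m).ρ i * (c₀ / nL m) := by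
        intro i
        have hq : 0 ≤ (θ m).ρ i * (c₀ / nL m) :=
          mul_nonneg ((θ m).ρ_nonneg i) (div_pos hc₀ (hnL m)).le
        split_ifs with hik
        · rw [hik, (θ m).A_self, mul_one, ← hik]
          linarith [(hρ m i).2]
        · rw [zero_add]
          exact mul_le_mul_of_nonneg_left (hA m i k hik) ((θ m).ρ_nonneg i)
      refine (Finset.sum_le_sum fun i _ => hterm i).trans (le_of_eq ?_)
      rw [Finset.sum_add_distrib, ← Finset.sum_mul, (θ m).ρ_sum, Finset.sum_ite_eq', one_mul,
        if_pos (Finset.mem_univ _), add_div]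
    · filter_upwards [eventually_mul_le_of_tendsto_div (Eventually.of_forall fun m =>
        mul_pos (mul_pos (pow_pos (hd m) 4) (pow_pos (hv m) 2)) (hn0 m)) h3 hM] with m hm
      exact hscale m M hM hm
  · rintro ⟨K, hK⟩ ⟨c, hc, hA⟩ h2 h3 h1 ε hε
    have hK0 : (0 : ℝ) < K := by rw [← hK 0]; exact hnL 0
    have hx1 : max c 0 < 1 := max_lt hc zero_lt_one
    refine tendsto_measure_le_maxError nL n T θ μ z G hsample zhat hzhat
      (c₁ := cmin * (1 - max c 0) ^ K) (C := K)
      (mul_pos hcmin (pow_pos (by linarith) _)) hK0 hcmax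
      (fun m i => (hρ m i).2) (Eventually.of_forall fun m i => ?_) (fun m k => ?_) d v hd hv hsep
      hn hT ?_ ?_ (fun M hM => ?_) hε
    · refine le_trans ?_ (sum_hubWeight_mul_soleHub_ge (θ m) i (x := max c 0)
        (le_max_right _ _) hx1.le fun k hk => (hA m i k hk.symm).trans (le_max_left _ _))
      rw [mul_div_right_comm, ← hK m]
      exact mul_le_mul_of_nonneg_right (hρ m i).1 (pow_nonneg (by linarith) _)
    · rw [← hK m, div_self (hnL m).ne', ← (θ m).ρ_sum]
      exact Finset.sum_le_sum fun i _ =>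
        mul_le_of_le_one_right ((θ m).ρ_nonneg i) ((θ m).A_le_one _ _)
    · simpa only [hK, mul_div_assoc, mul_zero] using h1.const_mul (K : ℝ)
    · simpa only [hK, mul_div_assoc, mul_zero] using h2.const_mul ((K : ℝ) ^ 3)
    · filter_upwards [h3.eventually_ge_atTop (M * ((K : ℝ) ^ 4 * Real.log K))] with m hm
      refine hscale m M hM ?_
      rw [hK m]
      exact hm
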